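/- **Game.** Let $1\le n\le N$ and $\ell\ge 0$. A code $\mathcal F$ and an adversary $\mathcal P$, both randomised (with independent randomness), stateful and computationally unbounded, play the following game. $\mathcal P$ selects $S^1\subseteq[N]$ with $|S^1|=n$, unknown to $\mathcal F$. In round $j=1,\dots,\ell$: $\mathcal F$ outputs a column $c^j\in\{\pm1\}^N$; $\mathcal P$ is shown the restriction of $c^j$ to $S^j$ and answers $a^j\in\{\pm1\}$, which is given to $\mathcal F$; $\mathcal F$ accuses a (possibly empty) set $I^j\subseteq[N]$, and $S^{j+1}=S^j\setminus I^j$. Put $$\theta^\ell=\bigl|\{k\in[\ell]:\ \nexists\, i\in[N],\ a^k=c^k_i\}\bigr|,\qquad \psi^\ell=\Bigl|\bigl(I^1\cup\dots\cup I^\ell\bigr)\setminus S^1\Bigr|.$$ $\mathcal F$ is an *$n$-collusion-resilient interactive fingerprinting code of length $\ell$ for $N$ users, robust to a $\beta$ fraction of errors, with failure probability $\varepsilon$ and false accusation probability $\delta$* if for every adversary $\mathcal P$ $$\Pr\bigl[\theta^\ell\le\beta\ell\ \text{ or }\ \psi^\ell>\delta(N-n)\bigr]\le\varepsilon .$$ **Tardos-type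 code.** For $\alpha,\zeta\in(0,1/2)$ let $\overline D_{\alpha,\zeta}$ be the distribution on $[0,1]$ that equals $0$ and $1$ with probability $\zeta$ each, and with probability $1-2\zeta$ is a sample from the distribution on $(\alpha,1-\alpha)$ with density proportional to $1/\sqrt{p(1-p)}$. Let $\phi^0=\phi^1=0$ and, for $p\in(0,1)$, $\phi^p(1)=\sqrt{(1-p)/p}$, $\phi^p(-1)=-\sqrt{p/(1-p)}$. The Tardos-type code with parameters $\alpha,\zeta,\sigma,\ell$ draws $p^1,\dots,p^\ell$ independently from $\overline D_{\alpha,\zeta}$ and, given these, independent entries $c^j_i\in\{\pm1\}$ with $\Pr[c^j_i=1]=p^j$; it issues the columns $c^j$, and in round $j$ it accuses every user $i$ whose score $s^j_i=\sum_{k\le j}a^k\phi^{p^k}(c^k_i)$ exceeds $\sigma$. **Theorem (existence of interactive fingerprinting codes).** There are absolute constants $C,c>0$ such that for all integers $1\le n\le N$ and all reals $0\le\beta<1/2$, $0<\delta\le1$ there are $\alpha,\zeta\in(0,1/2)$, $\sigma>0$ and $$\ell\ \le\ C\,\frac{n^2\log(2/\delta)}{(\frac12-\beta)^4}$$ such that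 the Tardos-type code with parameters $\alpha,\zeta,\sigma,\ell$ is an $n$-collusion-resilient interactive fingerprinting code of length $\ell$ for $N$ users, robust to a $\beta$ fraction of errors, with false accusation probability $\delta$ and failure probability $$\varepsilon=\min\bigl\{\delta(N-n),\,2^{-c\,\delta(N-n)}\bigr\}+\delta^{\,c\,(\frac12-\beta)\,n}.$$ -/

import Mathlib

/-!
Interactive fingerprinting codes. The alphabet `{±1}` is `Bool`, with `true` for `+1` and `false`
for `-1`. Users are `Fin N`, rounds are `Fin ℓ`. A randomised stateful party is modelled by a
random tape drawn at the beginning, together with, for each round, a function of the tape and of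
everything the party has received so far.
-/

namespace IFPC

open MeasureTheory

/-- What the adversary receives in one round: the entry of the column for each user who is still
in the coalition, and `none` for every other user. -/
abbrev View (N : ℕ) : Type := Fin N → Option Bool

/-- The (randomised, stateful) tracing algorithm for `N` users and `ℓ` rounds. In round `j` it
outputs a column as a function of its randomness and the answers of the rounds before `j`, and
after receiving the answer of round `j` it accuses a set of users. -/
structure Code (N ℓ : ℕ) where
  Ω : Type
  [measurableSpace : MeasurableSpace Ω]
  law : Measure Ω
  [isProbability : IsProbabilityMeasure law]
  column : (j : Fin ℓ) → Ω → (Set.Iio j → Bool) → Fin N → Bool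
  accuse : (j : Fin ℓ) → Ω → (Set.Iic j → Bool) → Finset (Fin N)
  measurable_column : ∀ j h i, Measurable fun ω => column j ω h i
  measurable_accuse : ∀ j h i, MeasurableSet {ω | i ∈ accuse j ω h}

attribute [instance] Code.measurableSpace Code.isProbability

/-- The (randomised, stateful, computationally unbounded) adversary. It selects a coalition of
exactly `n` users, and in round `j` it answers as a function of its randomness and of what it has
been shown in the rounds up to and including `j`. -/
structure Adversary (N n ℓ : ℕ) where
  Ω : Type
  [measurableSpace : MeasurableSpace Ω]
  law : Measure Ω
  [isProbability : IsProbabilityMeasure law]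
  coalition : Ω → Finset (Fin N)
  card_coalition : ∀ ω, (coalition ω).card = n
  answer : (j : Fin ℓ) → Ω → (Set.Iic j → View N) → Bool
  measurable_coalition : ∀ i, MeasurableSet {ω | i ∈ coalition ω}
  measurable_answer : ∀ j v, Measurable fun ω => answer j ω v

attribute [instance] Adversary.measurableSpace Adversary.isProbability

namespace Code

variable {N n ℓ : ℕ} (F : Code N ℓ)

/-- The column `c^j` issued when the answers are `a` (only the answers before `j` matter). -/
def columnAt (ω : F.Ω) (a : Fin ℓ → Bool) (j : Fin ℓ) : Fin N → Bool :=
  F.column j ω fun k => a k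

/-- The set `I^j` accused in round `j` when the answers are `a` (only the answers up to `j`
matter). -/
def accusedAt (ω : F.Ω) (a : Fin ℓ → Bool) (j : Fin ℓ) : Finset (Fin N) :=
  F.accuse j ω fun k => a k

/-- The remaining coalition `S^j = S^1 \ (I^1 ∪ ⋯ ∪ I^{j-1})`. -/
def coalitionAt (ω : F.Ω) (S : Finset (Fin N)) (a : Fin ℓ → Bool) (j : Fin ℓ) :
    Finset (Fin N) :=
  S \ (Finset.Iio j).biUnion (F.accusedAt ω a)

/-- The restriction of `c^j` to `S^j`, which is shown to the adversary in round `j`. -/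
def viewAt (ω : F.Ω) (S : Finset (Fin N)) (a : Fin ℓ → Bool) (j : Fin ℓ) : View N :=
  fun i => if i ∈ F.coalitionAt ω S a j then some (F.columnAt ω a j i) else none

/-- The answers after the first `t` rounds of the game. Entries of later rounds are padding by
`false`; they are never read, since the view of round `t` depends on earlier answers only. -/
def play (P : Adversary N n ℓ) (ω : F.Ω) (η : P.Ω) : ℕ → Fin ℓ → Bool
  | 0 => fun _ => false
  | t + 1 =>
    if h : t < ℓ then
      Function.update (play P ω η t) ⟨t, h⟩
        (P.answer ⟨t, h⟩ η fun k => F.viewAt ω (P.coalition η) (play P ω η t) k)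
    else play P ω η t

/-- The answers `a^1, …, a^ℓ` given in the whole game. -/
def answers (P : Adversary N n ℓ) (ω : F.Ω) (η : P.Ω) : Fin ℓ → Bool :=
  F.play P ω η ℓ

/-- `θ^ℓ`: the number of rounds whose answer differs from all entries of the column. -/
def inconsistencies (P : Adversary N n ℓ) (ω : F.Ω) (η : P.Ω) : ℕ :=
  (Finset.univ.filter fun k : Fin ℓ =>
    ¬ ∃ i, F.answers P ω η k = F.columnAt ω (F.answers P ω η) k i).card

/-- `ψ^ℓ`: the number of accused users who are not in the initial coalition. -/
def falseAccusations (P : Adversary N n ℓ) (ω : F.Ω) (η : P.Ω) : ℕ :=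
  ((Finset.univ.biUnion (F.accusedAt ω (F.answers P ω η))) \ P.coalition η).card

/-- `F` is an `n`-collusion-resilient interactive fingerprinting code of length `ℓ` for `N` users,
robust to a `β` fraction of errors, with failure probability `ε` and false accusation
probability `δ`. -/
def IsCollusionResilient (F : Code N ℓ) (n : ℕ) (β ε δ : ℝ) : Prop :=
  ∀ P : Adversary N n ℓ,
    (F.law.prod P.law).real
      {x | (F.inconsistencies P x.1 x.2 : ℝ) ≤ β * ℓ ∨
        δ * ((N : ℝ) - n) < (F.falseAccusations P x.1 x.2 : ℝ)} ≤ ε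

end Code

noncomputable section Tardos

/-- The measure with density `1 / √(p (1 - p))` on the interval `(a, b)`. -/
def arcsineWeight (a b : ℝ) : Measure ℝ :=
  (volume.restrict (Set.Ioo a b)).withDensity
    fun p => ENNReal.ofReal (1 / Real.sqrt (p * (1 - p)))

/-- The probability distribution `D_{a,b}`, with density proportional to `1 / √(p (1 - p))` on
`(a, b)`. -/
def arcsineLaw (a b : ℝ) : Measure ℝ :=
  (arcsineWeight a b Set.univ)⁻¹ • arcsineWeight a b

/-- The distribution of the biases: a sample of `D_{α,1-α}` with probability `1 - 2ζ`, and `0` or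
`1` with probability `ζ` each. -/
def biasLaw (α ζ : ℝ) : Measure ℝ :=
  ENNReal.ofReal (1 - 2 * ζ) • arcsineLaw α (1 - α) +
    (ENNReal.ofReal ζ • Measure.dirac 0 + ENNReal.ofReal ζ • Measure.dirac 1)

lemma isProbabilityMeasure_biasLaw {α ζ : ℝ} (hα : α ∈ Set.Ioo (0 : ℝ) (1 / 2))
    (hζ : ζ ∈ Set.Ioo (0 : ℝ) (1 / 2)) : IsProbabilityMeasure (biasLaw α ζ) := by
  obtain ⟨hα0, hα1⟩ := hα
  obtain ⟨hζ0, hζ1⟩ := hζ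
  have hpos : arcsineWeight α (1 - α) Set.univ ≠ 0 := by
    rw [arcsineWeight, withDensity_apply _ MeasurableSet.univ, Measure.restrict_univ]
    intro h0
    rw [lintegral_eq_zero_iff (by fun_prop)] at h0
    have h1 : ∀ᵐ p ∂(volume.restrict (Set.Ioo α (1 - α))), False := by
      filter_upwards [h0, ae_restrict_mem measurableSet_Ioo] with p hp hm
      have : 0 < p * (1 - p) := mul_pos (by linarith [hm.1]) (by linarith [hm.2])
      have h2 : 0 < 1 / Real.sqrt (p * (1 - p)) := by positivity
      simp only [Pi.zero_apply, ENNReal.ofReal_eq_zero] at hp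
      linarith
    rw [ae_iff] at h1
    simp at h1
    linarith
  have hfin : arcsineWeight α (1 - α) Set.univ ≠ ⊤ := by
    rw [arcsineWeight, withDensity_apply _ MeasurableSet.univ, Measure.restrict_univ]
    refine ((setLIntegral_mono' (g := fun _ => ENNReal.ofReal (1 / Real.sqrt (α * α)))
      measurableSet_Ioo ?_).trans_lt ?_).ne
    · intro p hm
      have h1 : α * α ≤ p * (1 - p) :=
        mul_le_mul hm.1.le (by linarith [hm.2]) hα0.le (by linarith [hm.1])
      have h2 : 0 < α * α := mul_pos hα0 hα0
      gcongr
    · simp [ENNReal.mul_lt_top_iff]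
  constructor
  have h : arcsineLaw α (1 - α) Set.univ = 1 := by
    simp [arcsineLaw, ENNReal.inv_mul_cancel hpos hfin]
  simp only [biasLaw, Measure.add_apply, Measure.smul_apply, h, measure_univ, smul_eq_mul,
    mul_one]
  rw [← ENNReal.ofReal_add hζ0.le hζ0.le, ← ENNReal.ofReal_add (by linarith) (by linarith)]
  simp; ring

/-- The function `φ^p` on `{±1}`, of mean zero and variance one with respect to `c ∼ p`. -/
def phi (p : ℝ) (c : Bool) : ℝ :=
  if p = 0 ∨ p = 1 then 0
  else if c then Real.sqrt ((1 - p) / p) else -Real.sqrt (p / (1 - p))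

/-- The real number `±1` encoded by a bit. -/
def sign (a : Bool) : ℝ := if a then 1 else -1

/-- The random tape of the Tardos code: a bias for each round, and a number in `[0, 1]` for each
round and each user. -/
abbrev Tape (N ℓ : ℕ) : Type := (Fin ℓ → ℝ) × (Fin ℓ → Fin N → unitInterval)

/-- The entry `c^j_i`. It is `+1` exactly when a uniform number of `[0, 1]` is below the bias
`p^j`; hence, given the biases, the entries are independent with `c^j_i ∼ p^j`. -/
def entry {N ℓ : ℕ} (ω : Tape N ℓ) (j : Fin ℓ) (i : Fin N) : Bool :=
  decide ((ω.2 j i : ℝ) < ω.1 j)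

/-- The score `s^j_i = ∑_{k ≤ j} a^k φ^{p^k}(c^k_i)`. -/
def score {N ℓ : ℕ} (ω : Tape N ℓ) (j : Fin ℓ) (a : Set.Iic j → Bool) (i : Fin N) : ℝ :=
  ∑ k : Set.Iic j, sign (a k) * phi (ω.1 k) (entry ω k i)

lemma measurable_entry {N ℓ : ℕ} (j : Fin ℓ) (i : Fin N) :
    Measurable fun ω : Tape N ℓ => entry ω j i := by
  refine measurable_to_bool ?_
  have : (fun ω : Tape N ℓ => entry ω j i) ⁻¹' {true} = {ω | (ω.2 j i : ℝ) < ω.1 j} := by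
    ext ω; simp [entry]
  rw [this]
  exact measurableSet_lt (by fun_prop) (by fun_prop)

lemma measurable_phi : Measurable fun x : ℝ × Bool => phi x.1 x.2 := by
  refine measurable_from_prod_countable_left fun c => ?_
  refine Measurable.ite ?_ measurable_const ?_
  · exact (measurableSet_singleton (0 : ℝ)).union (measurableSet_singleton (1 : ℝ))
  · cases c <;> simp <;> fun_prop

/-- The Tardos-type interactive fingerprinting code: independent biases `p^j` with distribution
`biasLaw α ζ`, columns `c^j ∼ p^j`, and accusation of every user whose score exceeds `σ`. -/
def tardosCode (N ℓ : ℕ) (α ζ σ : ℝ) (hα : α ∈ Set.Ioo (0 : ℝ) (1 / 2))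
    (hζ : ζ ∈ Set.Ioo (0 : ℝ) (1 / 2)) : Code N ℓ :=
  haveI := isProbabilityMeasure_biasLaw hα hζ
  { Ω := Tape N ℓ
    law := (Measure.pi fun _ => biasLaw α ζ).prod
      (Measure.pi fun _ => Measure.pi fun _ => (volume : Measure unitInterval))
    column := fun j ω _ => entry ω j
    accuse := fun j ω a => Finset.univ.filter fun i => σ < score ω j a i
    measurable_column := fun j _ i => measurable_entry j i
    measurable_accuse := fun j a i => by
      have h : Measurable fun ω : Tape N ℓ => score ω j a i := by
        refine Finset.measurable_sum _ fun k _ => Measurable.const_mul ?_ _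
        exact measurable_phi.comp
          (Measurable.prodMk (by fun_prop) (measurable_entry (k : Fin ℓ) i))
      simpa using measurableSet_lt measurable_const h }

end Tardos

end IFPC

/-! Fix the adversary's randomness. Each answer is then a function of the coalition's past tape and
of the bits that the remaining coalition sees now, and both ways to fail are bounded by exponential
moments, integrated one round at a time (`lintegral_tapeLaw_prod_le`). Write κ = 1/2 − β, L =
log(2/δ), and Z for the mass of 1/√(p(1−p)) on (α, 1−α). The parameters are ζ = (1−κ)/2, α = κ/(8n),
σ² = 8ℓL, with ℓ of order n²L/κ⁴.

Innocent users. No answer depends on the entries of a user outside the initial coalition, so such a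
score is a martingale with conditional variance at most 1 and steps at most 1/√α. Its exponential
supermartingale, stopped when the score first exceeds σ, shows that an accusation has probability at
most δ/4. Given the biases and the coalition's entries, the entries of the innocent users are
independent, so products of these supermartingales over distinct users still have mean at most 1
(`IsCausal.lintegral_prod_stoppedFactor_le_one`). Hence the number ψ of false accusations satisfies
E ψ ≤ (δ/4)(N−n) and E 2^ψ ≤ (1+δ/4)^(N−n), and Markov's inequality yields the two terms of the
minimum.

Guilty users. The total `gain` is at most n(σ + 1/√α) + γθ, because a guilty user stops contributing
once the score exceeds σ (`sum_gain_le`). On the other hand, let f be the current answer as a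
function of the bits seen. At bias p its correlation with ∑φ is √(p(1−p)) times the derivative in p
of its mean (`hasDerivAt_sum_prod_bern`), so averaging over the arcsine law telescopes to nearly
(f(1,…,1) − f(−1,…,−1))/Z. An inconsistent answer to a constant column lowers this by 2/Z, and the
reward γ, with γζ = 2κ/Z, compensates. So every strategy has mean gain at least (2κ/Z)(1−2αn) per
round; `IsCausal.lintegral_exp_neg_gain_le` is the exponential form of this. If θ ≤ βℓ, the rewards
amount to at most γβℓ ≤ (2κ/Z)(1−κ)ℓ, which leaves a surplus of order κ²ℓ, more than n(σ + 1/√α) can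
absorb (`exponent_le`). -/

namespace IFPC

open MeasureTheory Function
open scoped ENNReal

/-! ### Iterated integration over a product space -/

/-- A product of factors, each of which has conditional mean at most `B i` given the earlier
coordinates, has mean at most `∏ B i`. -/
lemma lintegral_finset_prod_le {ι : Type*} [Fintype ι] [LinearOrder ι] {E : ι → Type*}
    [∀ i, MeasurableSpace (E i)] (μ : ∀ i, Measure (E i)) [∀ i, IsProbabilityMeasure (μ i)]
    (G : ι → (∀ i, E i) → ℝ≥0∞) (B : ι → ℝ≥0∞) (T : Finset ι)
    (hG : ∀ i ∈ T, Measurable (G i))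
    (hdep : ∀ i ∈ T, ∀ j ∈ T, j < i → ∀ ω r, G j (update ω i r) = G j ω)
    (hB : ∀ i ∈ T, ∀ ω, ∫⁻ r, G i (update ω i r) ∂μ i ≤ B i) :
    ∫⁻ ω, ∏ i ∈ T, G i ω ∂Measure.pi μ ≤ ∏ i ∈ T, B i := by
  induction T using Finset.induction_on_max with
  | empty => simp
  | insert i T hi ih =>
    have hiT : i ∉ T := fun h => lt_irrefl _ (hi i h)
    have hmT : Measurable fun ω => ∏ k ∈ T, G k ω :=
      Finset.measurable_prod _ fun k hk => hG k (Finset.mem_insert_of_mem hk)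
    simp only [Finset.prod_insert hiT]
    calc ∫⁻ ω, G i ω * ∏ k ∈ T, G k ω ∂Measure.pi μ
        ≤ ∫⁻ ω, B i * ∏ k ∈ T, G k ω ∂Measure.pi μ := by
          -- Only the greatest coordinate is integrated out: all other factors ignore it, and the
          -- bound on its own factor is uniform in the remaining coordinates.
          refine lintegral_le_of_lmarginal_le {i}
            ((hG i (Finset.mem_insert_self _ _)).mul hmT) (hmT.const_mul _) ?_
          rw [lmarginal_singleton, lmarginal_singleton]
          intro ω
          have h : ∀ r, ∏ k ∈ T, G k (update ω i r) = ∏ k ∈ T, G k ω := fun r =>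
            Finset.prod_congr rfl fun k hk => hdep i (Finset.mem_insert_self _ _) k
              (Finset.mem_insert_of_mem hk) (hi k hk) ω r
          simp only [h]
          rw [lintegral_mul_const, lintegral_const, measure_univ, mul_one]
          · gcongr
            exact hB i (Finset.mem_insert_self _ _) ω
          · exact (hG i (Finset.mem_insert_self _ _)).comp (measurable_update ω)
      _ = B i * ∫⁻ ω, ∏ k ∈ T, G k ω ∂Measure.pi μ := lintegral_const_mul _ hmT
      _ ≤ B i * ∏ k ∈ T, B k := by
          gcongr
          exact ih (fun k hk => hG k (Finset.mem_insert_of_mem hk))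
            (fun k hk l hl => hdep k (Finset.mem_insert_of_mem hk) l (Finset.mem_insert_of_mem hl))
            (fun k hk => hB k (Finset.mem_insert_of_mem hk))

/-! ### The game: answers as the solution of the view equations, and measurability -/

namespace Code

variable {N n ℓ : ℕ} (F : Code N ℓ)

lemma accusedAt_congr (ω : F.Ω) {a a' : Fin ℓ → Bool} {j : Fin ℓ} (h : ∀ k ≤ j, a k = a' k) :
    F.accusedAt ω a j = F.accusedAt ω a' j := by
  unfold accusedAt
  congr 1
  funext k
  exact h k k.2

lemma coalitionAt_congr (ω : F.Ω) (S : Finset (Fin N)) {a a' : Fin ℓ → Bool} {j : Fin ℓ}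
    (h : ∀ k < j, a k = a' k) : F.coalitionAt ω S a j = F.coalitionAt ω S a' j := by
  unfold coalitionAt
  congr 1
  refine Finset.biUnion_congr rfl fun k hk => F.accusedAt_congr ω fun l hl => h l ?_
  exact lt_of_le_of_lt hl (Finset.mem_Iio.1 hk)

lemma viewAt_congr (ω : F.Ω) (S : Finset (Fin N)) {a a' : Fin ℓ → Bool} {j : Fin ℓ}
    (h : ∀ k < j, a k = a' k) : F.viewAt ω S a j = F.viewAt ω S a' j := by
  have h1 : F.columnAt ω a j = F.columnAt ω a' j := by
    unfold columnAt
    congr 1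
    funext k
    exact h k k.2
  unfold viewAt
  rw [F.coalitionAt_congr ω S h, h1]

lemma play_stable (P : Adversary N n ℓ) (ω : F.Ω) (η : P.Ω) (k : Fin ℓ) {s t : ℕ}
    (hk : (k : ℕ) < s) (hst : s ≤ t) : F.play P ω η t k = F.play P ω η s k := by
  induction t, hst using Nat.le_induction with
  | base => rfl
  | succ t hst ih =>
    rw [← ih, play]
    split_ifs with h
    · rw [Function.update_of_ne]
      intro hkt
      have := congrArg Fin.val hkt
      simp only at this
      omega
    · rfl

/-- The answers are determined by the rule that in each round the adversary answers on the basis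
of its views. -/
lemma answers_eq (P : Adversary N n ℓ) (ω : F.Ω) (η : P.Ω) (j : Fin ℓ) :
    F.answers P ω η j =
      P.answer j η fun k => F.viewAt ω (P.coalition η) (F.answers P ω η) k := by
  have h1 : F.answers P ω η j = F.play P ω η (j + 1) j :=
    F.play_stable P ω η j (Nat.lt_succ_self _) j.2
  rw [h1, play, dif_pos j.2, Function.update_self]
  congr 1
  funext k
  refine F.viewAt_congr ω _ fun l hl => ?_
  have hk : (k : Fin ℓ) ≤ j := k.2
  exact (F.play_stable P ω η l (lt_of_lt_of_le hl hk) j.2.le).symm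

/-- The view in round j uses only answers before j, so the equations have a unique solution, found
round by round. This removes the recursion from the event that the transcript equals `a`. -/
lemma eq_answers_iff (P : Adversary N n ℓ) (ω : F.Ω) (η : P.Ω) (a : Fin ℓ → Bool) :
    F.answers P ω η = a ↔
      ∀ j, P.answer j η (fun k => F.viewAt ω (P.coalition η) a k) = a j := by
  constructor
  · rintro rfl j
    exact (F.answers_eq P ω η j).symm
  · intro h
    have key : ∀ m : ℕ, ∀ j : Fin ℓ, (j : ℕ) = m → F.answers P ω η j = a j := by
      intro m
      induction m using Nat.strong_induction_on with
      | _ m ih =>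
        intro j hj
        rw [F.answers_eq, ← h j]
        congr 1
        funext k
        refine F.viewAt_congr ω _ fun l hl => ih l ?_ l rfl
        have hk : (k : Fin ℓ) ≤ j := k.2
        have hlj : l < j := lt_of_lt_of_le hl hk
        rw [← hj]
        exact hlj
    funext j
    exact key j j rfl

lemma measurableSet_mem_coalitionAt (S : Finset (Fin N)) (a : Fin ℓ → Bool) (j : Fin ℓ)
    (i : Fin N) : MeasurableSet {ω | i ∈ F.coalitionAt ω S a j} := by
  have : {ω | i ∈ F.coalitionAt ω S a j} =
      {_ω : F.Ω | i ∈ S} ∩ ⋂ k : Fin ℓ, ⋂ _ : k < j, {ω | i ∈ F.accusedAt ω a k}ᶜ := by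
    ext ω
    simp [coalitionAt]
  rw [this]
  exact (MeasurableSet.const _).inter (MeasurableSet.iInter fun k => MeasurableSet.iInter
    fun _ => (F.measurable_accuse k _ i).compl)

lemma measurableSet_viewAt_eq (S : Finset (Fin N)) (a : Fin ℓ → Bool) (j : Fin ℓ) (v : View N) :
    MeasurableSet {ω | F.viewAt ω S a j = v} := by
  have : {ω | F.viewAt ω S a j = v} =
      ⋂ i, ({ω | i ∈ F.coalitionAt ω S a j} ∩ {ω | some (F.columnAt ω a j i) = v i} ∪
        {ω | i ∈ F.coalitionAt ω S a j}ᶜ ∩ {_ω : F.Ω | none = v i}) := by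
    ext ω
    simp only [Set.mem_ofPred_eq, funext_iff, viewAt, Set.mem_iInter]
    refine forall_congr' fun i => ?_
    by_cases h : i ∈ F.coalitionAt ω S a j <;> simp [h]
  rw [this]
  refine MeasurableSet.iInter fun i => ?_
  have hm := F.measurableSet_mem_coalitionAt S a j i
  refine (hm.inter ?_).union (hm.compl.inter (MeasurableSet.const _))
  have hc : Measurable fun ω => F.columnAt ω a j i := F.measurable_column j _ i
  exact hc (show MeasurableSet {b : Bool | some b = v i} from trivial)

lemma measurableSet_coalition_eq (P : Adversary N n ℓ) (S : Finset (Fin N)) :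
    MeasurableSet {η | P.coalition η = S} := by
  have : {η | P.coalition η = S} =
      ⋂ i, ({η | i ∈ P.coalition η} ∩ {_η : P.Ω | i ∈ S} ∪
        {η | i ∈ P.coalition η}ᶜ ∩ {_η : P.Ω | i ∉ S}) := by
    ext η
    simp only [Set.mem_ofPred_eq, Finset.ext_iff, Set.mem_iInter, Set.mem_union, Set.mem_inter_iff,
      Set.mem_compl_iff]
    refine forall_congr' fun i => ?_
    tauto
  rw [this]
  exact MeasurableSet.iInter fun i =>
    ((P.measurable_coalition i).inter (MeasurableSet.const _)).union
      ((P.measurable_coalition i).compl.inter (MeasurableSet.const _))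

/-- An answer function is measurable in the tape only for a fixed view; splitting over the finitely
many coalitions and view sequences turns the event into finite unions and intersections of
rectangles. -/
lemma measurable_answers (P : Adversary N n ℓ) :
    Measurable fun x : F.Ω × P.Ω => F.answers P x.1 x.2 := by
  refine measurable_to_countable' fun a => ?_
  have : (fun x : F.Ω × P.Ω => F.answers P x.1 x.2) ⁻¹' {a} =
      ⋂ j : Fin ℓ, ⋃ S : Finset (Fin N), ⋃ v : Set.Iic j → View N,
        (⋂ k : Set.Iic j, {ω | F.viewAt ω S a k = v k}) ×ˢ
          ({η | P.coalition η = S} ∩ {η | P.answer j η v = a j}) := by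
    ext x
    simp only [Set.mem_preimage, Set.mem_singleton_iff, eq_answers_iff, Set.mem_iInter,
      Set.mem_iUnion, Set.mem_prod, Set.mem_inter_iff, Set.mem_ofPred_eq]
    refine forall_congr' fun j => ⟨fun h => ⟨_, _, fun k => rfl, rfl, h⟩, ?_⟩
    rintro ⟨S, v, hv, rfl, h⟩
    rw [← h]
    congr 1
    funext k
    exact hv k
  rw [this]
  refine MeasurableSet.iInter fun j => MeasurableSet.iUnion fun S => MeasurableSet.iUnion fun v =>
    MeasurableSet.prod (MeasurableSet.iInter fun k => F.measurableSet_viewAt_eq S a k _) ?_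
  exact (measurableSet_coalition_eq P S).inter
    (P.measurable_answer j v (measurableSet_singleton (a j)))

lemma measurableSet_failure (P : Adversary N n ℓ) (Q : ℕ → Prop) (R : ℕ → Prop) :
    MeasurableSet {x : F.Ω × P.Ω | Q (F.inconsistencies P x.1 x.2) ∨
      R (F.falseAccusations P x.1 x.2)} := by
  have hans (a : Fin ℓ → Bool) : MeasurableSet {x : F.Ω × P.Ω | F.answers P x.1 x.2 = a} :=
    F.measurable_answers P (measurableSet_singleton a)
  have hcol (a : Fin ℓ → Bool) (c : Fin ℓ → Fin N → Bool) :
      MeasurableSet {ω : F.Ω | ∀ k i, F.columnAt ω a k i = c k i} := by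
    simp only [Set.ofPred_forall]
    exact MeasurableSet.iInter fun k => MeasurableSet.iInter fun i =>
      F.measurable_column k _ i (measurableSet_singleton (c k i))
  have hacc (a : Fin ℓ → Bool) (I : Fin ℓ → Finset (Fin N)) :
      MeasurableSet {ω : F.Ω | ∀ k i, i ∈ F.accusedAt ω a k ↔ i ∈ I k} := by
    simp only [Set.ofPred_forall]
    refine MeasurableSet.iInter fun k => MeasurableSet.iInter fun i => ?_
    have h := F.measurable_accuse k (fun l => a l) i
    by_cases hi : i ∈ I k
    · simpa [hi, accusedAt] using h
    · simp only [hi, iff_false]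
      exact h.compl
  -- Answers, columns, accusations and coalition take finitely many values; once they are fixed, the
  -- failure condition is a constant proposition.
  have : {x : F.Ω × P.Ω | Q (F.inconsistencies P x.1 x.2) ∨
      R (F.falseAccusations P x.1 x.2)} =
      ⋃ a : Fin ℓ → Bool, ⋃ c : Fin ℓ → Fin N → Bool, ⋃ I : Fin ℓ → Finset (Fin N),
      ⋃ S : Finset (Fin N),
        {x : F.Ω × P.Ω | F.answers P x.1 x.2 = a} ∩
        ({ω : F.Ω | ∀ k i, F.columnAt ω a k i = c k i} ∩
          {ω : F.Ω | ∀ k i, i ∈ F.accusedAt ω a k ↔ i ∈ I k}) ×ˢ {η | P.coalition η = S} ∩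
        {_x : F.Ω × P.Ω | Q (Finset.univ.filter fun k : Fin ℓ => ¬ ∃ i, a k = c k i).card ∨
          R ((Finset.univ.biUnion I) \ S).card} := by
    ext x
    simp only [Set.mem_ofPred_eq, Set.mem_iUnion, Set.mem_inter_iff, Set.mem_prod]
    constructor
    · intro h
      exact ⟨_, _, _, _, ⟨rfl, ⟨fun k i => rfl, fun k i => Iff.rfl⟩, rfl⟩, h⟩
    · rintro ⟨a, c, I, S, ⟨rfl, ⟨hc, hI⟩, rfl⟩, h⟩
      obtain rfl : c = fun k i => F.columnAt x.1 (F.answers P x.1 x.2) k i := by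
        funext k i
        exact (hc k i).symm
      obtain rfl : I = F.accusedAt x.1 (F.answers P x.1 x.2) := by
        funext k
        ext i
        exact (hI k i).symm
      exact h
  rw [this]
  exact MeasurableSet.iUnion fun a => MeasurableSet.iUnion fun c => MeasurableSet.iUnion fun I =>
    MeasurableSet.iUnion fun S => ((hans a).inter (((hcol a c).inter (hacc a I)).prod
      (measurableSet_coalition_eq P S))).inter (MeasurableSet.const _)

/-- It suffices to bound the failure probability for each value of the adversary's randomness. -/
lemma isCollusionResilient_of_forall {β ε δ : ℝ} (hε : 0 ≤ ε)
    (h : ∀ (P : Adversary N n ℓ) (η : P.Ω), F.law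
      {ω | (F.inconsistencies P ω η : ℝ) ≤ β * ℓ ∨
        δ * ((N : ℝ) - n) < (F.falseAccusations P ω η : ℝ)} ≤ ENNReal.ofReal ε) :
    F.IsCollusionResilient n β ε δ := by
  intro P
  refine ENNReal.toReal_le_of_le_ofReal hε ?_
  have hm := F.measurableSet_failure P (fun m => (m : ℝ) ≤ β * ℓ)
    (fun m => δ * ((N : ℝ) - n) < (m : ℝ))
  rw [Measure.prod_apply_symm hm]
  calc _ ≤ ∫⁻ _η, ENNReal.ofReal ε ∂P.law := lintegral_mono fun η => h P η
    _ = ENNReal.ofReal ε := by simp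

end Code

/-! ### Deterministic adversaries against the Tardos-type code -/

noncomputable section

variable {N n ℓ : ℕ}

/-- The score of user `i` after round `j` when the answers are `a`. -/
def cumScore (ω : Tape N ℓ) (a : Fin ℓ → Bool) (j : Fin ℓ) (i : Fin N) : ℝ :=
  ∑ k ∈ Finset.Iic j, sign (a k) * phi (ω.1 k) (entry ω k i)

lemma score_eq_cumScore (ω : Tape N ℓ) (a : Fin ℓ → Bool) (j : Fin ℓ) (i : Fin N) :
    score ω j (fun k => a k) i = cumScore ω a j i := by
  unfold score cumScore
  exact (Finset.sum_subtype (Finset.Iic j) (p := fun x => x ∈ Set.Iic j) (by simp)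
    (fun k => sign (a k) * phi (ω.1 k) (entry ω k i))).symm

lemma entry_congr {ω ω' : Tape N ℓ} {k : Fin ℓ} {i : Fin N} (h1 : ω.1 k = ω'.1 k)
    (h2 : ω.2 k i = ω'.2 k i) : entry ω k i = entry ω' k i := by
  unfold entry
  rw [h1, h2]

lemma cumScore_congr {ω ω' : Tape N ℓ} {a a' : Fin ℓ → Bool} {j : Fin ℓ} {i : Fin N}
    (ha : ∀ k ≤ j, a k = a' k) (h1 : ∀ k ≤ j, ω.1 k = ω'.1 k)
    (h2 : ∀ k ≤ j, ω.2 k i = ω'.2 k i) : cumScore ω a j i = cumScore ω' a' j i := by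
  refine Finset.sum_congr rfl fun k hk => ?_
  have hk := Finset.mem_Iic.1 hk
  rw [ha k hk, h1 k hk, entry_congr (h1 k hk) (h2 k hk)]

/-- The users of `S` whose score has not exceeded `σ` before round `j`. -/
def remaining (σ : ℝ) (S : Finset (Fin N)) (ω : Tape N ℓ) (a : Fin ℓ → Bool) (j : Fin ℓ) :
    Finset (Fin N) :=
  S.filter fun i => ∀ k < j, cumScore ω a k i ≤ σ

lemma remaining_congr {σ : ℝ} {S : Finset (Fin N)} {ω ω' : Tape N ℓ} {a a' : Fin ℓ → Bool}
    {j : Fin ℓ} (ha : ∀ k < j, a k = a' k) (h1 : ∀ k < j, ω.1 k = ω'.1 k)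
    (h2 : ∀ k < j, ∀ i ∈ S, ω.2 k i = ω'.2 k i) :
    remaining σ S ω a j = remaining σ S ω' a' j := by
  refine Finset.filter_congr fun i hi => forall_congr' fun k => forall_congr' fun hk => ?_
  rw [cumScore_congr (fun l hl => ha l (hl.trans_lt hk)) (fun l hl => h1 l (hl.trans_lt hk))
    (fun l hl => h2 l (hl.trans_lt hk) i hi)]

/-- The answers `a`, as a function of the tape, of a deterministic adversary with coalition `S`
that plays against the Tardos-type code with threshold `σ`: each answer depends only on the tape
of the coalition in earlier rounds and on the current entries of the remaining coalition. -/
structure IsCausal (σ : ℝ) (S : Finset (Fin N)) (a : Tape N ℓ → Fin ℓ → Bool) : Prop where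
  measurable : ∀ j, Measurable fun ω => a ω j
  congr : ∀ ω ω' j, (∀ k < j, ω.1 k = ω'.1 k) → (∀ k < j, ∀ i ∈ S, ω.2 k i = ω'.2 k i) →
    (∀ i ∈ remaining σ S ω (a ω) j, entry ω j i = entry ω' j i) → a ω j = a ω' j

section tardosCode

variable {α ζ σ : ℝ} (hα : α ∈ Set.Ioo (0 : ℝ) (1 / 2)) (hζ : ζ ∈ Set.Ioo (0 : ℝ) (1 / 2))

lemma mem_accusedAt_tardosCode (ω : Tape N ℓ) (a : Fin ℓ → Bool) (j : Fin ℓ) (i : Fin N) :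
    i ∈ (tardosCode N ℓ α ζ σ hα hζ).accusedAt ω a j ↔ σ < cumScore ω a j i := by
  rw [← score_eq_cumScore]
  simp [Code.accusedAt, tardosCode]

lemma coalitionAt_tardosCode (ω : Tape N ℓ) (S : Finset (Fin N)) (a : Fin ℓ → Bool)
    (j : Fin ℓ) :
    (tardosCode N ℓ α ζ σ hα hζ).coalitionAt ω S a j = remaining σ S ω a j := by
  ext i
  simp only [Code.coalitionAt, Finset.mem_sdiff, Finset.mem_biUnion, Finset.mem_Iio,
    mem_accusedAt_tardosCode, remaining, Finset.mem_filter, not_exists, not_and, not_lt]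

lemma viewAt_tardosCode (ω : Tape N ℓ) (S : Finset (Fin N)) (a : Fin ℓ → Bool) (j : Fin ℓ) :
    (tardosCode N ℓ α ζ σ hα hζ).viewAt ω S a j =
      fun i => if i ∈ remaining σ S ω a j then some (entry ω j i) else none := by
  unfold Code.viewAt
  rw [coalitionAt_tardosCode]
  rfl

/-- By strong induction on the round, earlier answers agree on both tapes; hence so do the scores
and the remaining coalitions, and then all views that the current answer is based on. -/
lemma isCausal_answers (P : Adversary N n ℓ) (η : P.Ω) :
    IsCausal σ (P.coalition η)
      (fun ω => (tardosCode N ℓ α ζ σ hα hζ).answers P ω η) where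
  measurable j := by
    have h := (tardosCode N ℓ α ζ σ hα hζ).measurable_answers P
    exact (measurable_pi_apply j).comp (h.comp measurable_prodMk_right)
  congr := by
    have key : ∀ m : ℕ, ∀ j : Fin ℓ, (j : ℕ) = m → ∀ ω ω' : Tape N ℓ,
        (∀ k < j, ω.1 k = ω'.1 k) → (∀ k < j, ∀ i ∈ P.coalition η, ω.2 k i = ω'.2 k i) →
        (∀ i ∈ remaining σ (P.coalition η) ω ((tardosCode N ℓ α ζ σ hα hζ).answers P ω η) j,
          entry ω j i = entry ω' j i) →
        (tardosCode N ℓ α ζ σ hα hζ).answers P ω η j =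
          (tardosCode N ℓ α ζ σ hα hζ).answers P ω' η j := by
      intro m
      induction m using Nat.strong_induction_on with
      | _ m ih =>
        intro j hj ω ω' h1 h2 h3
        have hlt : ∀ k < j, (tardosCode N ℓ α ζ σ hα hζ).answers P ω η k =
            (tardosCode N ℓ α ζ σ hα hζ).answers P ω' η k := by
          intro k hk
          refine ih k (by rw [← hj]; exact hk) k rfl ω ω' (fun l hl => h1 l (hl.trans hk))
            (fun l hl => h2 l (hl.trans hk)) fun i hi => ?_
          exact entry_congr (h1 k hk) (h2 k hk i (Finset.mem_filter.1 hi).1)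
        refine ((tardosCode N ℓ α ζ σ hα hζ).answers_eq P ω η j).trans
          (Eq.trans ?_ ((tardosCode N ℓ α ζ σ hα hζ).answers_eq P ω' η j).symm)
        congr 1
        funext k
        have hk : (k : Fin ℓ) ≤ j := k.2
        refine (viewAt_tardosCode hα hζ ω _ _ _).trans
          (Eq.trans ?_ (viewAt_tardosCode hα hζ ω' _ _ _).symm)
        rw [← remaining_congr (fun l hl => hlt l (hl.trans_le hk))
            (fun l hl => h1 l (hl.trans_le hk))
            (fun l hl => h2 l (hl.trans_le hk))]
        funext i
        split_ifs with hi
        · congr 1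
          rcases hk.lt_or_eq with hk | hk
          · exact entry_congr (h1 k hk) (h2 k hk i (Finset.mem_filter.1 hi).1)
          · rw [hk] at hi ⊢
            exact h3 i hi
        · rfl
    exact fun ω ω' j => key j j rfl ω ω'

end tardosCode

/-! ### Conditioning on the past by resampling one round -/

/-- The tape `ω` with bias `p` and numbers `u` put into round `j`. -/
def refresh (ω : Tape N ℓ) (j : Fin ℓ) (p : ℝ) (u : Fin N → unitInterval) : Tape N ℓ :=
  (update ω.1 j p, update ω.2 j u)

lemma refresh_fst_of_lt (ω : Tape N ℓ) {j k : Fin ℓ} (hk : k < j) (p : ℝ)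
    (u : Fin N → unitInterval) : (refresh ω j p u).1 k = ω.1 k :=
  update_of_ne hk.ne _ _

lemma refresh_snd_of_lt (ω : Tape N ℓ) {j k : Fin ℓ} (hk : k < j) (p : ℝ)
    (u : Fin N → unitInterval) : (refresh ω j p u).2 k = ω.2 k :=
  update_of_ne hk.ne _ _

@[simp] lemma refresh_fst_self (ω : Tape N ℓ) (j : Fin ℓ) (p : ℝ)
    (u : Fin N → unitInterval) : (refresh ω j p u).1 j = p :=
  update_self _ _ _

@[simp] lemma entry_refresh_self (ω : Tape N ℓ) (j : Fin ℓ) (p : ℝ)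
    (u : Fin N → unitInterval) (i : Fin N) :
    entry (refresh ω j p u) j i = decide ((u i : ℝ) < p) := by
  simp [entry, refresh]

lemma entry_refresh_of_lt (ω : Tape N ℓ) {j k : Fin ℓ} (hk : k < j) (p : ℝ)
    (u : Fin N → unitInterval) (i : Fin N) : entry (refresh ω j p u) k i = entry ω k i :=
  entry_congr (refresh_fst_of_lt ω hk p u) (congrFun (refresh_snd_of_lt ω hk p u) i)

namespace IsCausal

variable {σ : ℝ} {S : Finset (Fin N)} {a : Tape N ℓ → Fin ℓ → Bool}

lemma refresh_of_lt (ha : IsCausal σ S a) (ω : Tape N ℓ) {j k : Fin ℓ} (hk : k < j) (p : ℝ)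
    (u : Fin N → unitInterval) : a (refresh ω j p u) k = a ω k := by
  refine ha.congr _ _ _ (fun l hl => refresh_fst_of_lt ω (hl.trans hk) p u)
    (fun l hl i _ => congrFun (refresh_snd_of_lt ω (hl.trans hk) p u) i)
    (fun i _ => entry_refresh_of_lt ω hk p u i)

lemma cumScore_refresh_of_lt (ha : IsCausal σ S a) (ω : Tape N ℓ) {j k : Fin ℓ} (hk : k < j)
    (p : ℝ) (u : Fin N → unitInterval) (i : Fin N) :
    cumScore (refresh ω j p u) (a (refresh ω j p u)) k i = cumScore ω (a ω) k i :=
  cumScore_congr (fun _ hl => ha.refresh_of_lt ω (hl.trans_lt hk) p u)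
    (fun _ hl => refresh_fst_of_lt ω (hl.trans_lt hk) p u)
    (fun _ hl => congrFun (refresh_snd_of_lt ω (hl.trans_lt hk) p u) i)

lemma remaining_refresh (ha : IsCausal σ S a) (ω : Tape N ℓ) {j k : Fin ℓ} (hk : k ≤ j)
    (p : ℝ) (u : Fin N → unitInterval) :
    remaining σ S (refresh ω j p u) (a (refresh ω j p u)) k = remaining σ S ω (a ω) k :=
  remaining_congr (fun _ hl => ha.refresh_of_lt ω (hl.trans_le hk) p u)
    (fun _ hl => refresh_fst_of_lt ω (hl.trans_le hk) p u)
    (fun _ hl i _ => congrFun (refresh_snd_of_lt ω (hl.trans_le hk) p u) i)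

/-- Given the past, the bias and the numbers reach the adversary only through the bits of the
remaining coalition. The two biases may differ, so one Boolean function describes the answer for all
`p` at once. -/
lemma refresh_self_congr (ha : IsCausal σ S a) (ω : Tape N ℓ) (j : Fin ℓ) {p p' : ℝ}
    {u u' : Fin N → unitInterval}
    (h : ∀ i ∈ remaining σ S ω (a ω) j, decide ((u i : ℝ) < p) = decide ((u' i : ℝ) < p')) :
    a (refresh ω j p u) j = a (refresh ω j p' u') j := by
  refine ha.congr _ _ _ (fun l hl => ?_) (fun l hl i _ => ?_) fun i hi => ?_
  · rw [refresh_fst_of_lt ω hl, refresh_fst_of_lt ω hl]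
  · rw [refresh_snd_of_lt ω hl, refresh_snd_of_lt ω hl]
  · rw [ha.remaining_refresh ω le_rfl] at hi
    simpa using h i hi

lemma measurable_cumScore (ha : IsCausal σ S a) (j : Fin ℓ) (i : Fin N) :
    Measurable fun ω => cumScore ω (a ω) j i := by
  refine Finset.measurable_sum _ fun k _ => Measurable.mul ?_ ?_
  · exact (measurable_of_finite sign).comp (ha.measurable k)
  · exact measurable_phi.comp (Measurable.prodMk (by fun_prop) (measurable_entry k i))

end IsCausal

/-- The law of the tape when the biases have law `ν`. -/
def tapeLaw (N ℓ : ℕ) (ν : Measure ℝ) : Measure (Tape N ℓ) :=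
  (Measure.pi fun _ => ν).prod
    (Measure.pi fun _ => Measure.pi fun _ => (volume : Measure unitInterval))

instance (ν : Measure ℝ) [IsProbabilityMeasure ν] : IsProbabilityMeasure (tapeLaw N ℓ ν) := by
  unfold tapeLaw
  infer_instance

/-- Regrouping the tape as one pair (bias, numbers) per round makes its law a product over rounds,
to which `lintegral_finset_prod_le` applies. -/
lemma lintegral_tapeLaw_prod_le (ν : Measure ℝ) [IsProbabilityMeasure ν]
    (G : Fin ℓ → Tape N ℓ → ℝ≥0∞) (B : ℝ≥0∞) (hG : ∀ j, Measurable (G j))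
    (hdep : ∀ j k, k < j → ∀ ω p u, G k (refresh ω j p u) = G k ω)
    (hB : ∀ j ω, ∫⁻ p, ∫⁻ u, G j (refresh ω j p u) ∂(Measure.pi fun _ => volume) ∂ν ≤ B) :
    ∫⁻ ω, ∏ j, G j ω ∂tapeLaw N ℓ ν ≤ B ^ ℓ := by
  have e := measurePreserving_arrowProdEquivProdArrow ℝ (Fin N → unitInterval) (Fin ℓ)
    (fun _ => ν) (fun _ => Measure.pi fun _ => volume)
  have hupd : ∀ (ω : Fin ℓ → ℝ × (Fin N → unitInterval)) j r,
      MeasurableEquiv.arrowProdEquivProdArrow ℝ (Fin N → unitInterval) (Fin ℓ) (update ω j r) =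
      refresh (MeasurableEquiv.arrowProdEquivProdArrow ℝ (Fin N → unitInterval) (Fin ℓ) ω)
        j r.1 r.2 := by
    intro ω j r
    refine Prod.ext ?_ ?_
    · funext k
      by_cases hk : k = j
      · subst hk; simp [refresh, MeasurableEquiv.arrowProdEquivProdArrow,
          Equiv.arrowProdEquivProdArrow]
      · simp [refresh, MeasurableEquiv.arrowProdEquivProdArrow,
          Equiv.arrowProdEquivProdArrow, hk]
    · funext k
      by_cases hk : k = j
      · subst hk; simp [refresh, MeasurableEquiv.arrowProdEquivProdArrow,
          Equiv.arrowProdEquivProdArrow]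
      · simp [refresh, MeasurableEquiv.arrowProdEquivProdArrow,
          Equiv.arrowProdEquivProdArrow, hk]
  unfold tapeLaw
  rw [← e.lintegral_comp (Finset.measurable_prod _ fun j _ => hG j)]
  have := lintegral_finset_prod_le (fun _ : Fin ℓ => ν.prod (Measure.pi fun _ : Fin N => volume))
    (fun j ω => G j (MeasurableEquiv.arrowProdEquivProdArrow ℝ (Fin N → unitInterval) (Fin ℓ) ω))
    (fun _ => B) Finset.univ (fun j _ => (hG j).comp (MeasurableEquiv.measurable _))
    (fun j _ k _ hk ω r => by rw [hupd, hdep j k hk])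
    (fun j _ ω => by
      simp only [hupd]
      rw [lintegral_prod]
      · exact hB j _
      · refine ((hG j).comp (Measurable.prodMk ?_ ?_)).aemeasurable
        · exact (measurable_update _).comp measurable_fst
        · exact (measurable_update _).comp measurable_snd)
  simpa using this

/-! ### Moments of φ under a biased bit -/

/-- The probability of the bit `b` when `+1` has probability `p`. -/
def bern (p : ℝ) (b : Bool) : ℝ := if b then p else 1 - p

lemma bern_nonneg {p : ℝ} (hp : p ∈ Set.Icc (0 : ℝ) 1) (b : Bool) : 0 ≤ bern p b := by
  cases b <;> simp [bern, hp.1, hp.2]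

lemma volume_decide_lt_eq {p : ℝ} (hp : p ∈ Set.Icc (0 : ℝ) 1) (b : Bool) :
    volume {u : unitInterval | decide ((u : ℝ) < p) = b} = ENNReal.ofReal (bern p b) := by
  cases b
  · have : {u : unitInterval | decide ((u : ℝ) < p) = false} = Set.Ici ⟨p, hp⟩ := by
      ext u
      simp [← Subtype.coe_le_coe]
    rw [this, unitInterval.volume_Ici]
    simp [bern]
  · have : {u : unitInterval | decide ((u : ℝ) < p) = true} = Set.Iio ⟨p, hp⟩ := by
      ext u
      simp [← Subtype.coe_lt_coe]
    rw [this, unitInterval.volume_Iio]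
    simp [bern]

lemma measurable_decide_lt (p : ℝ) :
    Measurable fun u : unitInterval => decide ((u : ℝ) < p) := by
  refine measurable_to_bool ?_
  have : (fun u : unitInterval => decide ((u : ℝ) < p)) ⁻¹' {true} =
      {u : unitInterval | (u : ℝ) < p} := by
    ext u; simp
  rw [this]
  exact measurableSet_lt (by fun_prop) (by fun_prop)

lemma lintegral_decide_lt {p : ℝ} (hp : p ∈ Set.Icc (0 : ℝ) 1) (h : Bool → ℝ≥0∞) :
    ∫⁻ u : unitInterval, h (decide ((u : ℝ) < p)) = ∑ b, ENNReal.ofReal (bern p b) * h b := by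
  rw [← lintegral_map (measurable_of_finite h) (measurable_decide_lt p), lintegral_fintype]
  refine Finset.sum_congr rfl fun b _ => ?_
  rw [Measure.map_apply (measurable_decide_lt p) (measurableSet_singleton b), mul_comm]
  congr 1
  exact volume_decide_lt_eq hp b

lemma lintegral_pi_decide_lt {p : ℝ} (hp : p ∈ Set.Icc (0 : ℝ) 1) (T : Finset (Fin N))
    (h : (T → Bool) → ℝ≥0∞) :
    ∫⁻ u : Fin N → unitInterval, h (fun i => decide ((u i : ℝ) < p))
      ∂(Measure.pi fun _ => volume) = ∑ c, ENNReal.ofReal (∏ i, bern p (c i)) * h c := by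
  have hm : Measurable fun (u : Fin N → unitInterval) (i : T) => decide ((u i : ℝ) < p) :=
    measurable_pi_lambda _ fun i => (measurable_decide_lt p).comp (measurable_pi_apply _)
  rw [← lintegral_map (measurable_of_finite h) hm, lintegral_fintype]
  refine Finset.sum_congr rfl fun c _ => ?_
  rw [Measure.map_apply hm (measurableSet_singleton c), mul_comm]
  congr 1
  -- The event is a box whose sides outside `T` are the whole interval.
  have : (fun (u : Fin N → unitInterval) (i : T) => decide ((u i : ℝ) < p)) ⁻¹' {c} =
      Set.pi Set.univ fun i => if hi : i ∈ T then
        {u : unitInterval | decide ((u : ℝ) < p) = c ⟨i, hi⟩} else Set.univ := by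
    ext u
    simp only [Set.mem_preimage, Set.mem_singleton_iff, funext_iff, Set.mem_pi, Set.mem_univ,
      true_implies, Subtype.forall]
    refine forall_congr' fun i => ?_
    by_cases hi : i ∈ T <;> simp [hi]
  rw [this, Measure.pi_pi, ENNReal.ofReal_prod_of_nonneg fun i _ => bern_nonneg hp _,
    ← Finset.prod_subset (Finset.subset_univ T) (fun i _ hi => by simp [hi]),
    ← Finset.prod_coe_sort]
  refine Finset.prod_congr rfl fun i _ => ?_
  simp only [i.2, dite_true]
  exact volume_decide_lt_eq hp _

lemma sign_sq (a : Bool) : sign a ^ 2 = 1 := by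
  cases a <;> simp [sign]

lemma abs_sign (a : Bool) : |sign a| = 1 := by
  cases a <;> simp [sign]

lemma sum_bern (p : ℝ) : ∑ b, bern p b = 1 := by
  simp [bern]

lemma phi_eq {p : ℝ} (hp : p ∈ Set.Ioo (0 : ℝ) 1) (b : Bool) :
    phi p b = if b then (1 - p) / √(p * (1 - p)) else -(p / √(p * (1 - p))) := by
  obtain ⟨h0, h1⟩ := hp
  have h2 : 0 < 1 - p := by linarith
  have hs : 0 < √(p * (1 - p)) := Real.sqrt_pos.2 (mul_pos h0 h2)
  have hq : √(p * (1 - p)) ^ 2 = p * (1 - p) := Real.sq_sqrt (mul_pos h0 h2).le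
  have e1 : √((1 - p) / p) = (1 - p) / √(p * (1 - p)) := by
    rw [Real.sqrt_eq_iff_mul_self_eq (by positivity) (by positivity), div_mul_div_comm, ← pow_two,
      ← pow_two, hq]
    field_simp
  have e2 : √(p / (1 - p)) = p / √(p * (1 - p)) := by
    rw [Real.sqrt_eq_iff_mul_self_eq (by positivity) (by positivity), div_mul_div_comm, ← pow_two,
      ← pow_two, hq]
    field_simp
  rw [phi, if_neg (by rintro (h | h) <;> linarith), e1, e2]

lemma sum_bern_mul_phi (p : ℝ) (hp : p ∈ Set.Icc (0 : ℝ) 1) :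
    ∑ b, bern p b * phi p b = 0 := by
  by_cases h : p = 0 ∨ p = 1
  · simp [phi, h]
  · push Not at h
    have hp' : p ∈ Set.Ioo (0 : ℝ) 1 := ⟨hp.1.lt_of_ne' h.1, hp.2.lt_of_ne h.2⟩
    simp only [Fintype.sum_bool, phi_eq hp', bern]
    simp
    ring

lemma sum_bern_mul_phi_sq_le (p : ℝ) (hp : p ∈ Set.Icc (0 : ℝ) 1) :
    ∑ b, bern p b * phi p b ^ 2 ≤ 1 := by
  by_cases h : p = 0 ∨ p = 1
  · simp [phi, h]
  · push Not at h
    have hp' : p ∈ Set.Ioo (0 : ℝ) 1 := ⟨hp.1.lt_of_ne' h.1, hp.2.lt_of_ne h.2⟩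
    have h2 : 0 < 1 - p := by linarith [hp'.2]
    have h1 : 0 < p := hp'.1
    have hq : √(p * (1 - p)) ^ 2 = p * (1 - p) := Real.sq_sqrt (mul_pos h1 h2).le
    simp only [Fintype.sum_bool, phi_eq hp', bern]
    simp only [if_true, Bool.false_eq_true, if_false, neg_sq, div_pow, hq]
    apply le_of_eq
    field_simp
    ring

/-- From e^x ≤ 1 + x + x² for |x| ≤ 1, mean zero and variance at most one. At p = 0 and p = 1 the
variance is 0, which is why only an inequality is available. -/
lemma sum_bern_mul_exp_le {p s : ℝ} (hp : p ∈ Set.Icc (0 : ℝ) 1)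
    (hs : ∀ b, |s * phi p b| ≤ 1) :
    ∑ b, bern p b * Real.exp (s * phi p b) ≤ Real.exp (s ^ 2) := by
  calc ∑ b, bern p b * Real.exp (s * phi p b)
      ≤ ∑ b, bern p b * (1 + s * phi p b + (s * phi p b) ^ 2) := by
        refine Finset.sum_le_sum fun b _ => mul_le_mul_of_nonneg_left ?_ (bern_nonneg hp b)
        have := (abs_le.1 (Real.abs_exp_sub_one_sub_id_le (hs b))).2
        linarith
    _ = ∑ b, bern p b + s * ∑ b, bern p b * phi p b + s ^ 2 * ∑ b, bern p b * phi p b ^ 2 := by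
        simp only [Fintype.sum_bool]
        ring
    _ ≤ 1 + s ^ 2 := by
        rw [sum_bern, sum_bern_mul_phi p hp]
        nlinarith [sum_bern_mul_phi_sq_le p hp, sq_nonneg s]
    _ ≤ Real.exp (s ^ 2) := by linarith [Real.add_one_le_exp (s ^ 2)]

/-! ### False accusations: stopped exponential supermartingales -/

/-- The factor of round `j` of the exponential supermartingale of the score of user `i`, stopped
when the score first exceeds `σ`. -/
def stoppedFactor (σ s : ℝ) (ω : Tape N ℓ) (a : Fin ℓ → Bool) (j : Fin ℓ) (i : Fin N) : ℝ :=
  open Classical in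
  if ∃ k < j, σ < cumScore ω a k i then 1
  else Real.exp (s * (sign (a j) * phi (ω.1 j) (entry ω j i)) - s ^ 2)

lemma stoppedFactor_nonneg (σ s : ℝ) (ω : Tape N ℓ) (a : Fin ℓ → Bool) (j : Fin ℓ)
    (i : Fin N) : 0 ≤ stoppedFactor σ s ω a j i := by
  unfold stoppedFactor
  split_ifs <;> positivity

/-- Let `j` be the first round where the score exceeds σ. Later factors are 1, and the earlier ones
multiply to the exponential of s times the score minus s² for each of at most ℓ rounds. -/
lemma exp_le_prod_stoppedFactor {σ s : ℝ} (hs : 0 ≤ s) (ω : Tape N ℓ) (a : Fin ℓ → Bool)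
    (i : Fin N) (h : ∃ j, σ < cumScore ω a j i) :
    Real.exp (s * σ - ℓ * s ^ 2) ≤ ∏ j, stoppedFactor σ s ω a j i := by
  classical
  obtain ⟨j, hj, hmin⟩ := WellFounded.has_min (wellFounded_lt (α := Fin ℓ))
    {j | σ < cumScore ω a j i} h
  have h1 : ∏ k, stoppedFactor σ s ω a k i =
      ∏ k ∈ Finset.Iic j, Real.exp (s * (sign (a k) * phi (ω.1 k) (entry ω k i)) - s ^ 2) := by
    rw [← Finset.prod_subset (Finset.subset_univ (Finset.Iic j))]
    · refine Finset.prod_congr rfl fun k hk => ?_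
      unfold stoppedFactor
      rw [if_neg]
      rintro ⟨l, hl, hlσ⟩
      exact hmin l hlσ (hl.trans_le (Finset.mem_Iic.1 hk))
    · intro k _ hk
      unfold stoppedFactor
      rw [if_pos]
      exact ⟨j, not_le.1 fun h => hk (Finset.mem_Iic.2 h), hj⟩
  rw [h1, ← Real.exp_sum, Finset.sum_sub_distrib, ← Finset.mul_sum, Real.exp_le_exp]
  have h2 : s * σ ≤ s * cumScore ω a j i := mul_le_mul_of_nonneg_left (le_of_lt hj) hs
  have h3 : ((Finset.Iic j).card : ℝ) ≤ ℓ := by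
    have := Finset.card_le_univ (Finset.Iic j)
    rw [Fintype.card_fin] at this
    exact_mod_cast this
  rw [Finset.sum_const, nsmul_eq_mul]
  change _ ≤ s * cumScore ω a j i - _
  have h4 := mul_le_mul_of_nonneg_right h3 (sq_nonneg s)
  linarith

section

variable {σ s : ℝ} {S : Finset (Fin N)} {a : Tape N ℓ → Fin ℓ → Bool}

lemma IsCausal.measurable_stoppedFactor (ha : IsCausal σ S a) (s : ℝ) (j : Fin ℓ) (i : Fin N) :
    Measurable fun ω => stoppedFactor σ s ω (a ω) j i := by
  classical
  unfold stoppedFactor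
  refine Measurable.ite ?_ measurable_const ?_
  · have : {ω | ∃ k < j, σ < cumScore ω (a ω) k i} =
        ⋃ k : Fin ℓ, ⋃ _ : k < j, {ω | σ < cumScore ω (a ω) k i} := by
      ext ω; simp
    rw [this]
    exact MeasurableSet.iUnion fun k => MeasurableSet.iUnion fun _ =>
      measurableSet_lt measurable_const (ha.measurable_cumScore k i)
  · refine Real.measurable_exp.comp (Measurable.sub_const (Measurable.const_mul
      (Measurable.mul ?_ ?_) _) _)
    · exact (measurable_of_finite sign).comp (ha.measurable j)
    · exact measurable_phi.comp (Measurable.prodMk (by fun_prop) (measurable_entry j i))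

lemma IsCausal.stoppedFactor_refresh_of_lt (ha : IsCausal σ S a) (s : ℝ) (ω : Tape N ℓ)
    {j k : Fin ℓ} (hk : k < j) (p : ℝ) (u : Fin N → unitInterval) (i : Fin N) :
    stoppedFactor σ s (refresh ω j p u) (a (refresh ω j p u)) k i =
      stoppedFactor σ s ω (a ω) k i := by
  classical
  unfold stoppedFactor
  rw [ha.refresh_of_lt ω hk, refresh_fst_of_lt ω hk, entry_refresh_of_lt ω hk]
  have : (∃ l < k, σ < cumScore (refresh ω j p u) (a (refresh ω j p u)) l i) ↔
      ∃ l < k, σ < cumScore ω (a ω) l i := by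
    refine exists_congr fun l => and_congr_right fun hl => ?_
    rw [ha.cumScore_refresh_of_lt ω (hl.trans hk)]
  simp only [this]

lemma IsCausal.stoppedFactor_refresh_self (ha : IsCausal σ S a) (s : ℝ) (ω : Tape N ℓ)
    (j : Fin ℓ) (p : ℝ) (u : Fin N → unitInterval) (i : Fin N) :
    stoppedFactor σ s (refresh ω j p u) (a (refresh ω j p u)) j i =
      open Classical in
      if ∃ k < j, σ < cumScore ω (a ω) k i then 1
      else Real.exp (s * (sign (a (refresh ω j p u) j) * phi p (decide ((u i : ℝ) < p)))
        - s ^ 2) := by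
  classical
  unfold stoppedFactor
  rw [refresh_fst_self, entry_refresh_self]
  have : (∃ l < j, σ < cumScore (refresh ω j p u) (a (refresh ω j p u)) l i) ↔
      ∃ l < j, σ < cumScore ω (a ω) l i := by
    refine exists_congr fun l => and_congr_right fun hl => ?_
    rw [ha.cumScore_refresh_of_lt ω hl]
  simp only [this]

lemma measurable_refresh_snd (ω : Tape N ℓ) (j : Fin ℓ) (p : ℝ) :
    Measurable fun u => refresh ω j p u :=
  measurable_const.prodMk (measurable_update _)

/-- Resampling a user of `T` leaves the answer unchanged, as `T` avoids the coalition. So users can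
be integrated out one by one, each contributing at most e^(s²) · e^(−s²) = 1. -/
lemma IsCausal.lintegral_stoppedFactor_refresh_le_one (ha : IsCausal σ S a) {T : Finset (Fin N)}
    (hT : Disjoint T S) (ω : Tape N ℓ) (j : Fin ℓ) {p : ℝ} (hp : p ∈ Set.Icc (0 : ℝ) 1)
    (hs : ∀ b, |s * phi p b| ≤ 1) :
    ∫⁻ u, ∏ i ∈ T, ENNReal.ofReal
      (stoppedFactor σ s (refresh ω j p u) (a (refresh ω j p u)) j i)
      ∂(Measure.pi fun _ => volume) ≤ 1 := by
  classical
  have hans : ∀ i ∈ T, ∀ u r, a (refresh ω j p (update u i r)) j = a (refresh ω j p u) j := by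
    intro i hi u r
    refine ha.refresh_self_congr ω j fun k hk => ?_
    have hne : k ≠ i := by
      rintro rfl
      exact Finset.disjoint_left.1 hT hi (Finset.mem_filter.1 hk).1
    rw [update_of_ne hne]
  have := lintegral_finset_prod_le (fun _ : Fin N => (volume : Measure unitInterval))
    (fun i u => ENNReal.ofReal (stoppedFactor σ s (refresh ω j p u) (a (refresh ω j p u)) j i))
    (fun _ => 1) T
    (fun i _ => ((ha.measurable_stoppedFactor s j i).comp
      (measurable_refresh_snd ω j p)).ennreal_ofReal)
    (fun i hi k hk hki u r => by
      simp only [ha.stoppedFactor_refresh_self, hans i hi u r, update_of_ne hki.ne])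
    (fun i hi u => by
      simp only [ha.stoppedFactor_refresh_self, hans i hi u, update_self]
      by_cases hc : ∃ k < j, σ < cumScore ω (a ω) k i
      · simp [hc]
      · simp only [hc, if_false]
        rw [lintegral_decide_lt hp fun b => ENNReal.ofReal (Real.exp
          (s * (sign (a (refresh ω j p u) j) * phi p b) - s ^ 2))]
        simp only [← ENNReal.ofReal_mul (bern_nonneg hp _)]
        rw [← ENNReal.ofReal_sum_of_nonneg fun b _ =>
          mul_nonneg (bern_nonneg hp b) (Real.exp_pos _).le]
        rw [← ENNReal.ofReal_one]
        refine ENNReal.ofReal_le_ofReal ?_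
        have h := sum_bern_mul_exp_le (s := s * sign (a (refresh ω j p u) j)) hp (fun b => by
          have := hs b
          rw [abs_mul] at this
          rw [abs_mul, abs_mul, abs_sign, mul_one]
          exact this)
        rw [mul_pow, sign_sq, mul_one] at h
        simp only [Real.exp_sub, ← mul_assoc]
        simp only [← mul_div_assoc]
        rw [← Finset.sum_div, div_le_one (Real.exp_pos _)]
        exact h)
  simpa using this

lemma IsCausal.lintegral_prod_stoppedFactor_le_one (ha : IsCausal σ S a) {T : Finset (Fin N)}
    (hT : Disjoint T S) (ν : Measure ℝ) [IsProbabilityMeasure ν]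
    (hν : ∀ᵐ p ∂ν, p ∈ Set.Icc (0 : ℝ) 1 ∧ ∀ b, |s * phi p b| ≤ 1) :
    ∫⁻ ω, ∏ i ∈ T, ∏ j, ENNReal.ofReal (stoppedFactor σ s ω (a ω) j i) ∂tapeLaw N ℓ ν ≤ 1 := by
  simp only [Finset.prod_comm (s := T)]
  have := lintegral_tapeLaw_prod_le ν
    (fun j ω => ∏ i ∈ T, ENNReal.ofReal (stoppedFactor σ s ω (a ω) j i)) 1
    (fun j => Finset.measurable_prod _ fun i _ =>
      (ha.measurable_stoppedFactor s j i).ennreal_ofReal)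
    (fun j k hk ω p u => by simp only [ha.stoppedFactor_refresh_of_lt s ω hk p u])
    (fun j ω => by
      calc _ ≤ ∫⁻ _p, 1 ∂ν := by
            refine lintegral_mono_ae ?_
            filter_upwards [hν] with p hp
            exact ha.lintegral_stoppedFactor_refresh_le_one hT ω j hp.1 hp.2
        _ = 1 := by simp)
  simpa using this

/-- The users outside of `S` whose score exceeds `σ` at some point. -/
def falselyAccused (σ : ℝ) (S : Finset (Fin N)) (ω : Tape N ℓ) (a : Fin ℓ → Bool) :
    Finset (Fin N) :=
  open Classical in Sᶜ.filter fun i => ∃ j, σ < cumScore ω a j i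

/-- Up to the factor `q`, the stopped supermartingale of a user dominates the indicator of the
accusation of this user. -/
lemma one_le_mul_prod_stoppedFactor (hs : 0 ≤ s) {q : ℝ}
    (hq : Real.exp (-(s * σ - ℓ * s ^ 2)) ≤ q) {ω : Tape N ℓ} {b : Fin ℓ → Bool} {i : Fin N}
    (hi : i ∈ falselyAccused σ S ω b) :
    1 ≤ ENNReal.ofReal q * ∏ j, ENNReal.ofReal (stoppedFactor σ s ω b j i) := by
  classical
  have h := exp_le_prod_stoppedFactor hs ω b i (Finset.mem_filter.1 hi).2
  rw [← ENNReal.ofReal_prod_of_nonneg fun j _ => stoppedFactor_nonneg σ s ω b j i,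
    ← ENNReal.ofReal_mul ((Real.exp_pos _).le.trans hq), ← ENNReal.ofReal_one]
  refine ENNReal.ofReal_le_ofReal ?_
  calc (1 : ℝ) = Real.exp (-(s * σ - ℓ * s ^ 2)) * Real.exp (s * σ - ℓ * s ^ 2) := by
        rw [← Real.exp_add]; simp
    _ ≤ _ := mul_le_mul hq h (Real.exp_pos _).le ((Real.exp_pos _).le.trans hq)

lemma IsCausal.lintegral_card_falselyAccused_le (ha : IsCausal σ S a) (hs : 0 ≤ s) {q : ℝ}
    (hq : Real.exp (-(s * σ - ℓ * s ^ 2)) ≤ q) (ν : Measure ℝ) [IsProbabilityMeasure ν]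
    (hν : ∀ᵐ p ∂ν, p ∈ Set.Icc (0 : ℝ) 1 ∧ ∀ b, |s * phi p b| ≤ 1) :
    ∫⁻ ω, ((falselyAccused σ S ω (a ω)).card : ℝ≥0∞) ∂tapeLaw N ℓ ν ≤
      Sᶜ.card * ENNReal.ofReal q := by
  classical
  calc ∫⁻ ω, ((falselyAccused σ S ω (a ω)).card : ℝ≥0∞) ∂tapeLaw N ℓ ν
      ≤ ∫⁻ ω, ∑ i ∈ Sᶜ, ENNReal.ofReal q *
          ∏ j, ENNReal.ofReal (stoppedFactor σ s ω (a ω) j i) ∂tapeLaw N ℓ ν := by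
        refine lintegral_mono fun ω => ?_
        calc ((falselyAccused σ S ω (a ω)).card : ℝ≥0∞)
            = ∑ _i ∈ falselyAccused σ S ω (a ω), (1 : ℝ≥0∞) := by simp
          _ ≤ ∑ i ∈ falselyAccused σ S ω (a ω), ENNReal.ofReal q *
              ∏ j, ENNReal.ofReal (stoppedFactor σ s ω (a ω) j i) :=
              Finset.sum_le_sum fun i hi => one_le_mul_prod_stoppedFactor hs hq hi
          _ ≤ _ := Finset.sum_le_sum_of_subset (Finset.filter_subset _ _)
    _ = ∑ i ∈ Sᶜ, ENNReal.ofReal q *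
          ∫⁻ ω, ∏ j, ENNReal.ofReal (stoppedFactor σ s ω (a ω) j i) ∂tapeLaw N ℓ ν := by
        have hm (i : Fin N) : Measurable fun ω =>
            ∏ j, ENNReal.ofReal (stoppedFactor σ s ω (a ω) j i) :=
          Finset.measurable_prod _ fun j _ => (ha.measurable_stoppedFactor s j i).ennreal_ofReal
        rw [lintegral_finsetSum _ fun i _ => (hm i).const_mul _]
        exact Finset.sum_congr rfl fun i _ => lintegral_const_mul _ (hm i)
    _ ≤ ∑ _i ∈ Sᶜ, ENNReal.ofReal q * 1 := by
        refine Finset.sum_le_sum fun i hi => ?_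
        gcongr
        have hd : Disjoint {i} S :=
          Finset.disjoint_singleton_left.2 (Finset.mem_compl.1 hi)
        simpa using ha.lintegral_prod_stoppedFactor_le_one hd ν hν
    _ = Sᶜ.card * ENNReal.ofReal q := by simp

/-- An accused user has q·M ≥ 1, where M is the stopped supermartingale at the end, so 2^ψ ≤ ∏ (1 +
q·M). Expanding over subsets `T`, each product over `T` has mean at most 1, as if the users were
independent. -/
lemma IsCausal.lintegral_two_pow_card_falselyAccused_le (ha : IsCausal σ S a) (hs : 0 ≤ s)
    {q : ℝ} (hq : Real.exp (-(s * σ - ℓ * s ^ 2)) ≤ q) (ν : Measure ℝ) [IsProbabilityMeasure ν]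
    (hν : ∀ᵐ p ∂ν, p ∈ Set.Icc (0 : ℝ) 1 ∧ ∀ b, |s * phi p b| ≤ 1) :
    ∫⁻ ω, 2 ^ (falselyAccused σ S ω (a ω)).card ∂tapeLaw N ℓ ν ≤
      (1 + ENNReal.ofReal q) ^ Sᶜ.card := by
  classical
  have hm (i : Fin N) : Measurable fun ω =>
      ∏ j, ENNReal.ofReal (stoppedFactor σ s ω (a ω) j i) :=
    Finset.measurable_prod _ fun j _ => (ha.measurable_stoppedFactor s j i).ennreal_ofReal
  calc ∫⁻ ω, 2 ^ (falselyAccused σ S ω (a ω)).card ∂tapeLaw N ℓ ν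
      ≤ ∫⁻ ω, ∏ i ∈ Sᶜ, (1 + ENNReal.ofReal q *
          ∏ j, ENNReal.ofReal (stoppedFactor σ s ω (a ω) j i)) ∂tapeLaw N ℓ ν := by
        refine lintegral_mono fun ω => ?_
        calc (2 : ℝ≥0∞) ^ (falselyAccused σ S ω (a ω)).card
            = ∏ _i ∈ falselyAccused σ S ω (a ω), (1 + 1 : ℝ≥0∞) := by
              simp [one_add_one_eq_two]
          _ ≤ ∏ i ∈ falselyAccused σ S ω (a ω), (1 + ENNReal.ofReal q *
              ∏ j, ENNReal.ofReal (stoppedFactor σ s ω (a ω) j i)) :=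
              Finset.prod_le_prod' fun i hi => by
                gcongr
                exact one_le_mul_prod_stoppedFactor hs hq hi
          _ ≤ _ := Finset.prod_le_prod_of_subset_of_one_le' (Finset.filter_subset _ _)
              fun i _ _ => le_self_add
    _ = ∑ T ∈ Sᶜ.powerset, ENNReal.ofReal q ^ T.card * ∫⁻ ω, ∏ i ∈ T,
          ∏ j, ENNReal.ofReal (stoppedFactor σ s ω (a ω) j i) ∂tapeLaw N ℓ ν := by
        simp only [Finset.prod_one_add, Finset.prod_mul_distrib, Finset.prod_const]
        have hm' (T : Finset (Fin N)) : Measurable fun ω => ∏ i ∈ T,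
            ∏ j, ENNReal.ofReal (stoppedFactor σ s ω (a ω) j i) :=
          Finset.measurable_prod _ fun i _ => hm i
        rw [lintegral_finsetSum _ fun T _ => (hm' T).const_mul _]
        exact Finset.sum_congr rfl fun T _ => lintegral_const_mul _ (hm' T)
    _ ≤ ∑ T ∈ Sᶜ.powerset, ENNReal.ofReal q ^ T.card * 1 := by
        refine Finset.sum_le_sum fun T hT => ?_
        gcongr
        refine ha.lintegral_prod_stoppedFactor_le_one ?_ ν hν
        exact Finset.disjoint_left.2 fun i hi => Finset.mem_compl.1 (Finset.mem_powerset.1 hT hi)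
    _ = (1 + ENNReal.ofReal q) ^ Sᶜ.card := by
        simp only [mul_one]
        rw [← Finset.prod_const, Finset.prod_one_add]
        simp

lemma IsCausal.measurable_card_falselyAccused (ha : IsCausal σ S a) :
    Measurable fun ω => (falselyAccused σ S ω (a ω)).card := by
  classical
  unfold falselyAccused
  simp only [Finset.card_filter]
  refine Finset.measurable_sum _ fun i _ => Measurable.ite ?_ measurable_const measurable_const
  have : {ω | ∃ j, σ < cumScore ω (a ω) j i} = ⋃ j, {ω | σ < cumScore ω (a ω) j i} := by
    ext ω; simp
  rw [this]
  exact MeasurableSet.iUnion fun j => measurableSet_lt measurable_const (ha.measurable_cumScore j i)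

/-- The number of false accusations exceeds `δ m` with small probability only. -/
lemma IsCausal.measure_falselyAccused_le (ha : IsCausal σ S a) (hs : 0 ≤ s) {δ : ℝ} (hδ : 0 ≤ δ)
    (hq : Real.exp (-(s * σ - ℓ * s ^ 2)) ≤ δ / 4) (ν : Measure ℝ) [IsProbabilityMeasure ν]
    (hν : ∀ᵐ p ∂ν, p ∈ Set.Icc (0 : ℝ) 1 ∧ ∀ b, |s * phi p b| ≤ 1) :
    tapeLaw N ℓ ν {ω | δ * (Sᶜ.card : ℝ) < ((falselyAccused σ S ω (a ω)).card : ℝ)} ≤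
      ENNReal.ofReal (min (δ * Sᶜ.card) ((2 : ℝ) ^ (-(1 / 2 * (δ * Sᶜ.card))))) := by
  set m : ℝ := (Sᶜ.card : ℝ) with hm
  have hm0 : 0 ≤ m := Nat.cast_nonneg _
  have hδm : 0 ≤ δ * m := mul_nonneg hδ hm0
  have hmeas := ha.measurable_card_falselyAccused
  rw [ENNReal.ofReal_min]
  refine le_min ?_ ?_
  · calc tapeLaw N ℓ ν {ω | δ * m < ((falselyAccused σ S ω (a ω)).card : ℝ)}
        ≤ 1 * tapeLaw N ℓ ν {ω | 1 ≤ ((falselyAccused σ S ω (a ω)).card : ℝ≥0∞)} := by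
          rw [one_mul]
          refine measure_mono fun ω hω => ?_
          have h1 : (0 : ℝ) < ((falselyAccused σ S ω (a ω)).card : ℝ) := lt_of_le_of_lt hδm hω
          have h2 : 0 < (falselyAccused σ S ω (a ω)).card := by exact_mod_cast h1
          exact_mod_cast h2
      _ ≤ ∫⁻ ω, ((falselyAccused σ S ω (a ω)).card : ℝ≥0∞) ∂tapeLaw N ℓ ν :=
          mul_meas_ge_le_lintegral ((measurable_of_countable _).comp hmeas) 1
      _ ≤ Sᶜ.card * ENNReal.ofReal (δ / 4) := ha.lintegral_card_falselyAccused_le hs hq ν hν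
      _ = ENNReal.ofReal (m * (δ / 4)) := by
          rw [ENNReal.ofReal_mul hm0, hm, ENNReal.ofReal_natCast]
      _ ≤ ENNReal.ofReal (δ * m) := ENNReal.ofReal_le_ofReal (by nlinarith)
  · have h2pos : (0 : ℝ) < 2 ^ (δ * m) := Real.rpow_pos_of_pos two_pos _
    have h1 : ENNReal.ofReal (2 ^ (δ * m)) * tapeLaw N ℓ ν
        {ω | δ * m < ((falselyAccused σ S ω (a ω)).card : ℝ)} ≤
        ENNReal.ofReal (Real.exp (δ * m / 4)) := by
      calc _ ≤ ENNReal.ofReal (2 ^ (δ * m)) * tapeLaw N ℓ ν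
            {ω | ENNReal.ofReal (2 ^ (δ * m)) ≤ 2 ^ (falselyAccused σ S ω (a ω)).card} := by
            gcongr with ω
            intro hω
            have h3 : (2 : ℝ) ^ (δ * m) ≤ 2 ^ (falselyAccused σ S ω (a ω)).card := by
              rw [← Real.rpow_natCast]
              exact Real.rpow_le_rpow_of_exponent_le one_le_two (le_of_lt hω)
            calc ENNReal.ofReal (2 ^ (δ * m))
                ≤ ENNReal.ofReal (2 ^ (falselyAccused σ S ω (a ω)).card) :=
                  ENNReal.ofReal_le_ofReal h3
              _ = 2 ^ (falselyAccused σ S ω (a ω)).card := by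
                  rw [ENNReal.ofReal_pow zero_le_two]
                  simp
        _ ≤ ∫⁻ ω, 2 ^ (falselyAccused σ S ω (a ω)).card ∂tapeLaw N ℓ ν :=
            mul_meas_ge_le_lintegral ((measurable_of_countable (fun k : ℕ => (2 : ℝ≥0∞) ^ k)).comp
              hmeas) _
        _ ≤ (1 + ENNReal.ofReal (δ / 4)) ^ Sᶜ.card :=
            ha.lintegral_two_pow_card_falselyAccused_le hs hq ν hν
        _ = ENNReal.ofReal ((1 + δ / 4) ^ Sᶜ.card) := by
            rw [ENNReal.ofReal_pow (by positivity), ENNReal.ofReal_add zero_le_one (by positivity),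
              ENNReal.ofReal_one]
        _ ≤ ENNReal.ofReal (Real.exp (δ * m / 4)) := by
            refine ENNReal.ofReal_le_ofReal ?_
            calc (1 + δ / 4) ^ Sᶜ.card ≤ Real.exp (δ / 4) ^ Sᶜ.card := by
                  gcongr
                  linarith [Real.add_one_le_exp (δ / 4)]
              _ = Real.exp (δ * m / 4) := by
                  rw [← Real.exp_nat_mul]
                  congr 1
                  rw [hm]
                  ring
    calc tapeLaw N ℓ ν {ω | δ * m < ((falselyAccused σ S ω (a ω)).card : ℝ)}
        = ENNReal.ofReal ((2 ^ (δ * m))⁻¹) * (ENNReal.ofReal (2 ^ (δ * m)) * tapeLaw N ℓ ν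
            {ω | δ * m < ((falselyAccused σ S ω (a ω)).card : ℝ)}) := by
          rw [← mul_assoc, ← ENNReal.ofReal_mul (by positivity), inv_mul_cancel₀ h2pos.ne',
            ENNReal.ofReal_one, one_mul]
      _ ≤ ENNReal.ofReal ((2 ^ (δ * m))⁻¹) * ENNReal.ofReal (Real.exp (δ * m / 4)) := by gcongr
      _ ≤ ENNReal.ofReal ((2 : ℝ) ^ (-(1 / 2 * (δ * m)))) := by
          rw [← ENNReal.ofReal_mul (by positivity)]
          refine ENNReal.ofReal_le_ofReal ?_
          rw [← Real.rpow_neg zero_le_two, Real.rpow_def_of_pos two_pos,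
            Real.rpow_def_of_pos two_pos, ← Real.exp_add, Real.exp_le_exp]
          -- The comparison of exponents reduces to 1/4 ≤ (log 2)/2.
          nlinarith [Real.log_two_gt_d9]

end

/-! ### Boolean functions of biased bits: exponential moments and derivative in the bias -/

section FiniteSums

variable {ι : Type*} [Fintype ι]

lemma prod_bern_nonneg {p : ℝ} (hp : p ∈ Set.Icc (0 : ℝ) 1) (c : ι → Bool) :
    0 ≤ ∏ i, bern p (c i) :=
  Finset.prod_nonneg fun i _ => bern_nonneg hp (c i)

variable [DecidableEq ι]

lemma sum_prod_bool (g : ι → Bool → ℝ) : ∑ c : ι → Bool, ∏ i, g i (c i) = ∏ i, ∑ b, g i b := by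
  rw [Finset.prod_univ_sum, Fintype.piFinset_univ]

lemma sum_prod_bern (p : ℝ) : ∑ c : ι → Bool, ∏ i, bern p (c i) = 1 := by
  rw [sum_prod_bool (fun _ => bern p)]
  simp only [sum_bern, Finset.prod_const_one]

lemma sum_prod_bern_mul_exp_le {p s : ℝ} (hp : p ∈ Set.Icc (0 : ℝ) 1)
    (hs : ∀ b, |s * phi p b| ≤ 1) {n : ℕ} (hn : Fintype.card ι ≤ n) :
    ∑ c : ι → Bool, (∏ i, bern p (c i)) * Real.exp (s * ∑ i, phi p (c i)) ≤
      Real.exp (n * s ^ 2) := by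
  have h1 : ∀ c : ι → Bool, (∏ i, bern p (c i)) * Real.exp (s * ∑ i, phi p (c i)) =
      ∏ i, bern p (c i) * Real.exp (s * phi p (c i)) := by
    intro c
    rw [Finset.mul_sum, Real.exp_sum, Finset.prod_mul_distrib]
  simp only [h1]
  rw [sum_prod_bool fun _ b => bern p b * Real.exp (s * phi p b)]
  calc ∏ _i : ι, ∑ b, bern p b * Real.exp (s * phi p b) ≤ ∏ _i : ι, Real.exp (s ^ 2) :=
        Finset.prod_le_prod
          (fun i _ => Finset.sum_nonneg fun b _ =>
            mul_nonneg (bern_nonneg hp b) (Real.exp_pos _).le)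
          fun i _ => sum_bern_mul_exp_le hp hs
    _ = Real.exp (Fintype.card ι * s ^ 2) := by
        rw [Finset.prod_const, ← Real.exp_nat_mul]
        rfl
    _ ≤ Real.exp (n * s ^ 2) := by gcongr

/-- The error term is even in y and hence free of the answer. This matters because the answer
depends on all the bits, while the moments of exp(±y) alone still factor over users. -/
lemma exp_neg_sign_mul_le (a : Bool) (y : ℝ) :
    Real.exp (-(sign a * y)) ≤ 1 - sign a * y + (Real.exp y + Real.exp (-y) - 2) := by
  have h1 := Real.add_one_le_exp y
  have h2 := Real.add_one_le_exp (-y)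
  cases a <;> simp [sign] <;> linarith

/-- The exponential moment of the correlation of the answer with the entries is controlled by its
mean. -/
lemma sum_prod_bern_mul_exp_neg_le {p s : ℝ} (hp : p ∈ Set.Icc (0 : ℝ) 1)
    (hs : ∀ b, |s * phi p b| ≤ 1) {n : ℕ} (hn : Fintype.card ι ≤ n) (f : (ι → Bool) → Bool) :
    ∑ c : ι → Bool, (∏ i, bern p (c i)) *
        Real.exp (-(s * ∑ i, sign (f c) * phi p (c i))) ≤
      1 - s * ∑ c : ι → Bool, (∏ i, bern p (c i)) * (sign (f c) * ∑ i, phi p (c i))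
        + 2 * (Real.exp (n * s ^ 2) - 1) := by
  have h1 := sum_prod_bern_mul_exp_le hp hs hn
  have h2 := sum_prod_bern_mul_exp_le (s := -s) hp (by simpa using hs) hn
  rw [neg_sq] at h2
  calc ∑ c : ι → Bool, (∏ i, bern p (c i)) * Real.exp (-(s * ∑ i, sign (f c) * phi p (c i)))
      ≤ ∑ c : ι → Bool, (∏ i, bern p (c i)) * (1 - sign (f c) * (s * ∑ i, phi p (c i)) +
          (Real.exp (s * ∑ i, phi p (c i)) + Real.exp (-(s * ∑ i, phi p (c i))) - 2)) := by
        refine Finset.sum_le_sum fun c _ =>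
          mul_le_mul_of_nonneg_left ?_ (prod_bern_nonneg hp c)
        have h3 : s * ∑ i, sign (f c) * phi p (c i) = sign (f c) * (s * ∑ i, phi p (c i)) := by
          rw [← Finset.mul_sum]
          ring
        rw [h3]
        exact exp_neg_sign_mul_le (f c) (s * ∑ i, phi p (c i))
    _ = ∑ c : ι → Bool, (-(∏ i, bern p (c i)) -
          s * ((∏ i, bern p (c i)) * (sign (f c) * ∑ i, phi p (c i))) +
          (∏ i, bern p (c i)) * Real.exp (s * ∑ i, phi p (c i)) +
          (∏ i, bern p (c i)) * Real.exp (-s * ∑ i, phi p (c i))) := by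
        refine Finset.sum_congr rfl fun c _ => ?_
        rw [neg_mul]
        ring
    _ ≤ _ := by
        rw [Finset.sum_add_distrib, Finset.sum_add_distrib, Finset.sum_sub_distrib,
          Finset.sum_neg_distrib, sum_prod_bern, ← Finset.mul_sum]
        linarith

/-- The derivative in `p` of an expectation over independent bits of bias `p`. -/
lemma hasDerivAt_sum_prod_bern {p : ℝ} (hp : p ∈ Set.Ioo (0 : ℝ) 1) (F : (ι → Bool) → ℝ) :
    HasDerivAt (fun p => ∑ c : ι → Bool, (∏ i, bern p (c i)) * F c)
      ((∑ c : ι → Bool, (∏ i, bern p (c i)) * (F c * ∑ i, phi p (c i))) / √(p * (1 - p))) p := by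
  have hpos : 0 < p * (1 - p) := mul_pos hp.1 (by linarith [hp.2])
  have ht : 0 < √(p * (1 - p)) := Real.sqrt_pos.2 hpos
  have hq : √(p * (1 - p)) ^ 2 = p * (1 - p) := Real.sq_sqrt hpos.le
  have hb : ∀ b, HasDerivAt (fun p => bern p b) (sign b) p := by
    intro b
    cases b
    · simpa [bern, sign] using (hasDerivAt_id p).const_sub 1
    · exact hasDerivAt_id p
  -- φ/√(p(1−p)) is the logarithmic derivative of the probability of a bit, so the product rule
  -- produces the sum of the φ's.
  have hφ : ∀ b, bern p b * phi p b / √(p * (1 - p)) = sign b := by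
    intro b
    have h1 : √(p * (1 - p)) * √(p * (1 - p)) = p * (1 - p) := by rw [← pow_two, hq]
    have h3 : p ≠ 0 := hp.1.ne'
    have h4 : 1 - p ≠ 0 := by linarith [hp.2]
    rw [phi_eq hp]
    cases b
    · simp only [bern, sign, Bool.false_eq_true, if_false]
      rw [mul_neg, neg_div, mul_div_assoc', div_div, h1]
      field_simp
    · simp only [bern, sign, if_true]
      rw [mul_div_assoc', div_div, h1]
      field_simp
  rw [Finset.sum_div]
  refine HasDerivAt.fun_sum fun c _ => ?_
  have h := (HasDerivAt.fun_finsetProd (u := Finset.univ) (f := fun i p => bern p (c i))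
    fun i _ => hb (c i)).mul_const (F c)
  refine h.congr_deriv (Eq.symm ?_)
  rw [mul_div_assoc, mul_div_assoc, Finset.sum_div, mul_comm (F c), ← mul_assoc, Finset.mul_sum]
  congr 1
  refine Finset.sum_congr rfl fun i _ => ?_
  rw [← hφ (c i), ← Finset.mul_prod_erase _ _ (Finset.mem_univ i), smul_eq_mul]
  ring

lemma abs_sum_prod_bern_sub_le {p : ℝ} (hp : p ∈ Set.Icc (0 : ℝ) 1) (F : (ι → Bool) → ℝ)
    (hF : ∀ c, |F c| ≤ 1) (c₀ : ι → Bool) :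
    |∑ c : ι → Bool, (∏ i, bern p (c i)) * F c - F c₀| ≤ 2 * (1 - ∏ i, bern p (c₀ i)) := by
  have h1 : ∑ c : ι → Bool, (∏ i, bern p (c i)) * F c - F c₀ =
      ∑ c : ι → Bool, (∏ i, bern p (c i)) * (F c - F c₀) := by
    simp only [mul_sub, Finset.sum_sub_distrib]
    rw [← Finset.sum_mul, sum_prod_bern, one_mul]
  rw [h1, ← Finset.add_sum_erase _ _ (Finset.mem_univ c₀), sub_self, mul_zero, zero_add,
    ← sum_prod_bern (ι := ι) p, ← Finset.add_sum_erase _ _ (Finset.mem_univ c₀),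
    add_sub_cancel_left, Finset.mul_sum]
  refine (Finset.abs_sum_le_sum_abs _ _).trans (Finset.sum_le_sum fun c _ => ?_)
  rw [abs_mul, abs_of_nonneg (prod_bern_nonneg hp c), mul_comm]
  refine mul_le_mul_of_nonneg_right ?_ (prod_bern_nonneg hp c)
  calc |F c - F c₀| ≤ |F c| + |F c₀| := abs_sub _ _
    _ ≤ 2 := by linarith [hF c, hF c₀]

/-- Near an endpoint the bits are constant except with probability at most nα, by Bernoulli's
inequality; replacing the mean by the value at the constant vector costs at most 2nα at each end. -/
lemma le_sum_prod_bern_sub {α : ℝ} (hα : α ∈ Set.Icc (0 : ℝ) 1) {n : ℕ}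
    (hn : Fintype.card ι ≤ n) (f : (ι → Bool) → Bool) :
    sign (f fun _ => true) - sign (f fun _ => false) - 4 * α * n ≤
      ∑ c : ι → Bool, (∏ i, bern (1 - α) (c i)) * sign (f c) -
        ∑ c : ι → Bool, (∏ i, bern α (c i)) * sign (f c) := by
  have hpow : 1 - n * α ≤ (1 - α) ^ Fintype.card ι := by
    have h := one_add_mul_le_pow (a := -α) (by linarith [hα.2]) (Fintype.card ι)
    have h' : (Fintype.card ι : ℝ) * α ≤ n * α :=
      mul_le_mul_of_nonneg_right (by exact_mod_cast hn) hα.1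
    rw [← sub_eq_add_neg] at h
    linarith
  have h1 := abs_sum_prod_bern_sub_le (p := 1 - α) ⟨by linarith [hα.2], by linarith [hα.1]⟩
    (fun c : ι → Bool => sign (f c)) (fun c => (abs_sign _).le) fun _ => true
  have h2 := abs_sum_prod_bern_sub_le hα
    (fun c : ι → Bool => sign (f c)) (fun c => (abs_sign _).le) fun _ => false
  simp only [bern, if_true, Bool.false_eq_true, if_false, Finset.prod_const,
    Finset.card_univ] at h1 h2
  have h1' := (abs_le.1 h1).1
  have h2' := (abs_le.1 h2).2
  simp only [bern]
  linarith

end FiniteSums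

/-! ### The arcsine law on (α, 1−α) -/

section Arcsine

variable {α : ℝ}

/-- The total mass of the weight `1 / √(p (1 - p))` on `(α, 1 - α)`. -/
def arcsineMass (α : ℝ) : ℝ := ∫ p in Set.Ioo α (1 - α), 1 / √(p * (1 - p))

lemma continuousOn_arcsineDensity (hα : 0 < α) :
    ContinuousOn (fun p : ℝ => 1 / √(p * (1 - p))) (Set.Icc α (1 - α)) := by
  refine ContinuousOn.div continuousOn_const (by fun_prop) fun p hp => ?_
  exact (Real.sqrt_pos.2 (mul_pos (by linarith [hp.1]) (by linarith [hp.2]))).ne'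

lemma integrableOn_arcsineDensity (hα : 0 < α) :
    IntegrableOn (fun p : ℝ => 1 / √(p * (1 - p))) (Set.Ioo α (1 - α)) :=
  (continuousOn_arcsineDensity hα).integrableOn_Icc.mono_set Set.Ioo_subset_Icc_self

lemma arcsineWeight_univ (hα : 0 < α) :
    arcsineWeight α (1 - α) Set.univ = ENNReal.ofReal (arcsineMass α) := by
  rw [arcsineWeight, withDensity_apply _ MeasurableSet.univ, Measure.restrict_univ, arcsineMass,
    ofReal_integral_eq_lintegral_ofReal (integrableOn_arcsineDensity hα)]
  exact Filter.Eventually.of_forall fun p => by positivity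

lemma one_le_arcsineMass (hα : 0 < α) (hα' : α ≤ 1 / 4) : 1 ≤ arcsineMass α := by
  have h : ∫ _p in Set.Ioo α (1 - α), (2 : ℝ) ≤ arcsineMass α := by
    refine setIntegral_mono_on (by simp) (integrableOn_arcsineDensity hα) measurableSet_Ioo ?_
    intro p hp
    have hpos : 0 < p * (1 - p) := mul_pos (by linarith [hp.1]) (by linarith [hp.2])
    rw [le_div_iff₀ (Real.sqrt_pos.2 hpos)]
    have : √(p * (1 - p)) ≤ 1 / 2 :=
      Real.sqrt_le_iff.2 ⟨by norm_num, by nlinarith [sq_nonneg (p - 1 / 2)]⟩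
    linarith
  rw [setIntegral_const, Measure.real, Real.volume_Ioo, ENNReal.toReal_ofReal (by linarith),
    smul_eq_mul] at h
  linarith

/-- The density has primitive arcsin(2p − 1), so the mass is at most π. -/
lemma arcsineMass_le (hα : 0 < α) (hα' : α ≤ 1 / 4) : arcsineMass α ≤ 4 := by
  have hle : α ≤ 1 - α := by linarith
  have h1 : arcsineMass α = ∫ p in α..(1 - α), 1 / √(p * (1 - p)) := by
    rw [arcsineMass, intervalIntegral.integral_of_le hle, integral_Ioc_eq_integral_Ioo]
  have h2 : ∫ p in α..(1 - α), 1 / √(p * (1 - p)) =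
      Real.arcsin (2 * (1 - α) - 1) - Real.arcsin (2 * α - 1) := by
    refine intervalIntegral.integral_eq_sub_of_hasDerivAt (f := fun p => Real.arcsin (2 * p - 1))
      (fun p hp => ?_) ?_
    · rw [Set.uIcc_of_le hle] at hp
      have hp0 : 0 < p := by linarith [hp.1]
      have hp1 : 0 < 1 - p := by linarith [hp.2]
      have h3 : HasDerivAt (fun p : ℝ => 2 * p - 1) 2 p := by
        simpa using ((hasDerivAt_id p).const_mul 2).sub_const 1
      have h4 := (Real.hasDerivAt_arcsin (x := 2 * p - 1) (by linarith) (by linarith)).comp p h3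
      refine h4.congr_deriv (Eq.symm ?_)
      have h5 : 1 - (2 * p - 1) ^ 2 = 2 ^ 2 * (p * (1 - p)) := by ring
      rw [h5, Real.sqrt_mul (show (0 : ℝ) ≤ 2 ^ 2 by norm_num), Real.sqrt_sq zero_le_two]
      have : √(p * (1 - p)) ≠ 0 := (Real.sqrt_pos.2 (mul_pos hp0 hp1)).ne'
      field_simp
    · refine ContinuousOn.intervalIntegrable ?_
      rw [Set.uIcc_of_le hle]
      exact continuousOn_arcsineDensity hα
  rw [h1, h2]
  linarith [Real.arcsin_le_pi_div_two (2 * (1 - α) - 1), Real.neg_pi_div_two_le_arcsin (2 * α - 1),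
    Real.pi_lt_four]

lemma isProbabilityMeasure_arcsineLaw (hα : 0 < α) (hα' : α ≤ 1 / 4) :
    IsProbabilityMeasure (arcsineLaw α (1 - α)) := by
  constructor
  have h : 0 < arcsineMass α := by linarith [one_le_arcsineMass hα hα']
  rw [arcsineLaw, Measure.smul_apply, smul_eq_mul, arcsineWeight_univ hα]
  exact ENNReal.inv_mul_cancel (by simpa using h) ENNReal.ofReal_ne_top

lemma ae_arcsineLaw (α : ℝ) : ∀ᵐ p ∂arcsineLaw α (1 - α), p ∈ Set.Ioo α (1 - α) := by
  have h1 : arcsineLaw α (1 - α) ≪ volume.restrict (Set.Ioo α (1 - α)) :=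
    (Measure.smul_absolutelyContinuous).trans (withDensity_absolutelyContinuous _ _)
  exact h1.ae_le (ae_restrict_mem measurableSet_Ioo)

/-- Integration by the fundamental theorem of calculus against the arcsine law. -/
lemma integral_arcsineLaw_sqrt_mul (hα : 0 < α) (hα' : α ≤ 1 / 4) {g h : ℝ → ℝ}
    (hg : ∀ p ∈ Set.Ioo (0 : ℝ) 1, HasDerivAt g (h p / √(p * (1 - p))) p)
    (hh : ContinuousOn h (Set.Ioo 0 1)) :
    Integrable h (arcsineLaw α (1 - α)) ∧
      ∫ p, h p ∂arcsineLaw α (1 - α) = (g (1 - α) - g α) / arcsineMass α := by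
  have hle : α ≤ 1 - α := by linarith
  have hM : 0 < arcsineMass α := by linarith [one_le_arcsineMass hα hα']
  have hsub : Set.Icc α (1 - α) ⊆ Set.Ioo 0 1 := fun p hp =>
    ⟨by linarith [hp.1], by linarith [hp.2]⟩
  have hc : ContinuousOn (fun p => 1 / √(p * (1 - p)) * h p) (Set.Icc α (1 - α)) :=
    (continuousOn_arcsineDensity hα).mul (hh.mono hsub)
  have hmeas : Measurable fun p : ℝ => ENNReal.ofReal (1 / √(p * (1 - p))) := by fun_prop
  have hto : ∀ p : ℝ, (ENNReal.ofReal (1 / √(p * (1 - p)))).toReal = 1 / √(p * (1 - p)) :=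
    fun p => ENNReal.toReal_ofReal (by positivity)
  have hint : Integrable h (arcsineWeight α (1 - α)) := by
    rw [arcsineWeight, integrable_withDensity_iff_integrable_smul' hmeas
      (Filter.Eventually.of_forall fun p => ENNReal.ofReal_lt_top)]
    simp only [hto, smul_eq_mul]
    exact hc.integrableOn_Icc.mono_set Set.Ioo_subset_Icc_self
  have hval : ∫ p, h p ∂arcsineWeight α (1 - α) = g (1 - α) - g α := by
    rw [arcsineWeight, integral_withDensity_eq_integral_toReal_smul hmeas
      (Filter.Eventually.of_forall fun p => ENNReal.ofReal_lt_top)]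
    simp only [hto, smul_eq_mul]
    rw [← integral_Ioc_eq_integral_Ioo, ← intervalIntegral.integral_of_le hle]
    refine intervalIntegral.integral_eq_sub_of_hasDerivAt (fun p hp => ?_) ?_
    · rw [Set.uIcc_of_le hle] at hp
      refine (hg p (hsub hp)).congr_deriv ?_
      ring
    · refine ContinuousOn.intervalIntegrable ?_
      rwa [Set.uIcc_of_le hle]
  constructor
  · refine hint.smul_measure ?_
    rw [arcsineWeight_univ hα]
    simpa using hM
  · rw [arcsineLaw, integral_smul_measure, hval, arcsineWeight_univ hα, ENNReal.toReal_inv,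
      ENNReal.toReal_ofReal hM.le, smul_eq_mul]
    ring

end Arcsine

/-! ### Bounds on φ, the bias law, and the mean correlation -/

lemma continuousOn_phi (b : Bool) : ContinuousOn (fun p => phi p b) (Set.Ioo 0 1) := by
  have hs : ∀ p ∈ Set.Ioo (0 : ℝ) 1, √(p * (1 - p)) ≠ 0 := fun p hp =>
    (Real.sqrt_pos.2 (mul_pos hp.1 (by linarith [hp.2]))).ne'
  refine ContinuousOn.congr (f := fun p : ℝ =>
    if b then (1 - p) / √(p * (1 - p)) else -(p / √(p * (1 - p)))) ?_ fun p hp => phi_eq hp b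
  cases b
  · simp only [Bool.false_eq_true, if_false]
    exact (ContinuousOn.div (by fun_prop) (by fun_prop) hs).neg
  · simp only [if_true]
    exact ContinuousOn.div (by fun_prop) (by fun_prop) hs

lemma abs_phi_le {α p : ℝ} (hα : 0 < α) (hp : p ∈ Set.Ioo α (1 - α)) (b : Bool) :
    |phi p b| ≤ 1 / √α := by
  have h0 : 0 < p := hα.trans hp.1
  have h1 : 0 < 1 - p := by linarith [hp.2]
  have e : 1 / √α = √(1 / α) := by rw [Real.sqrt_div zero_le_one, Real.sqrt_one]
  rw [phi, if_neg (by rintro (h | h) <;> linarith), e]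
  cases b
  · simp only [Bool.false_eq_true, if_false, abs_neg]
    rw [abs_of_nonneg (Real.sqrt_nonneg _)]
    refine Real.sqrt_le_sqrt ?_
    rw [div_le_div_iff₀ h1 hα]
    nlinarith [hp.1, hp.2]
  · simp only [if_true]
    rw [abs_of_nonneg (Real.sqrt_nonneg _)]
    refine Real.sqrt_le_sqrt ?_
    rw [div_le_div_iff₀ h0 hα]
    nlinarith [hp.1, hp.2]

lemma lintegral_biasLaw (α : ℝ) {ζ : ℝ} (Ψ : ℝ → ℝ≥0∞) :
    ∫⁻ p, Ψ p ∂biasLaw α ζ = ENNReal.ofReal (1 - 2 * ζ) * ∫⁻ p, Ψ p ∂arcsineLaw α (1 - α) +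
      (ENNReal.ofReal ζ * Ψ 0 + ENNReal.ofReal ζ * Ψ 1) := by
  rw [biasLaw, lintegral_add_measure, lintegral_add_measure, lintegral_smul_measure,
    lintegral_smul_measure, lintegral_smul_measure, lintegral_dirac, lintegral_dirac]
  rfl

lemma ae_biasLaw (α ζ : ℝ) :
    ∀ᵐ p ∂biasLaw α ζ, p ∈ Set.Ioo α (1 - α) ∨ p = 0 ∨ p = 1 := by
  rw [biasLaw, ae_add_measure_iff, ae_add_measure_iff]
  refine ⟨Measure.ae_smul_measure ((ae_arcsineLaw α).mono fun p hp => Or.inl hp) _,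
    Measure.ae_smul_measure ?_ _, Measure.ae_smul_measure ?_ _⟩
  · rw [ae_dirac_eq]; exact Or.inr (Or.inl rfl)
  · rw [ae_dirac_eq]; exact Or.inr (Or.inr rfl)

lemma ae_biasLaw_abs_phi_le {α : ℝ} (hα : 0 < α) (ζ : ℝ) :
    ∀ᵐ p ∂biasLaw α ζ, p ∈ Set.Icc (0 : ℝ) 1 ∧ ∀ b, |phi p b| ≤ 1 / √α := by
  filter_upwards [ae_biasLaw α ζ] with p hp
  rcases hp with hp | hp
  · exact ⟨⟨by linarith [hp.1], by linarith [hp.2]⟩, abs_phi_le hα hp⟩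
  · refine ⟨by rcases hp with rfl | rfl <;> simp, fun b => ?_⟩
    rw [phi, if_pos hp, abs_zero]
    positivity

/-- The linear term integrates by the fundamental theorem of calculus to a difference of means at 1
− α and α. `A` is the integral of the pointwise upper bound; it is kept abstract because its
nonnegativity is needed for `ENNReal` arithmetic and is not visible from the explicit estimate. -/
lemma lintegral_arcsineLaw_exp_le {ι : Type*} [Fintype ι] [DecidableEq ι] {α s : ℝ} (hα : 0 < α)
    (hα' : α ≤ 1 / 4) (hs : 0 ≤ s) (hsα : s ≤ √α) (hn : Fintype.card ι ≤ n)
    (f : (ι → Bool) → Bool) :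
    ∃ A : ℝ, 0 ≤ A ∧
      A ≤ 1 - s * ((sign (f fun _ => true) - sign (f fun _ => false) - 4 * α * n) / arcsineMass α)
        + 2 * (Real.exp (n * s ^ 2) - 1) ∧
      ∫⁻ p, ENNReal.ofReal (∑ c : ι → Bool, (∏ i, bern p (c i)) *
        Real.exp (-(s * ∑ i, sign (f c) * phi p (c i)))) ∂arcsineLaw α (1 - α) ≤
        ENNReal.ofReal A := by
  have := isProbabilityMeasure_arcsineLaw hα hα'
  have hM : 0 < arcsineMass α := by linarith [one_le_arcsineMass hα hα']
  set h : ℝ → ℝ := fun p =>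
    ∑ c : ι → Bool, (∏ i, bern p (c i)) * (sign (f c) * ∑ i, phi p (c i)) with hh
  have hcont : ContinuousOn h (Set.Ioo 0 1) := by
    refine continuousOn_finsetSum _ fun c _ => ContinuousOn.mul ?_ (ContinuousOn.mul
      continuousOn_const (continuousOn_finsetSum _ fun i _ => continuousOn_phi _))
    refine continuousOn_finsetProd _ fun i _ => ?_
    unfold bern
    cases c i
    · simp only [Bool.false_eq_true, if_false]; fun_prop
    · simp only [if_true]; fun_prop
  obtain ⟨hint, hval⟩ := integral_arcsineLaw_sqrt_mul hα hα'
    (fun p hp => hasDerivAt_sum_prod_bern hp fun c : ι → Bool => sign (f c)) hcont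
  set K : ℝ := 2 * (Real.exp (n * s ^ 2) - 1) with hK
  have hpt : ∀ᵐ p ∂arcsineLaw α (1 - α), ∑ c : ι → Bool, (∏ i, bern p (c i)) *
        Real.exp (-(s * ∑ i, sign (f c) * phi p (c i))) ≤ 1 - s * h p + K := by
    filter_upwards [ae_arcsineLaw α] with p hp
    refine sum_prod_bern_mul_exp_neg_le ⟨by linarith [hp.1], by linarith [hp.2]⟩ (fun b => ?_) hn f
    rw [abs_mul, abs_of_nonneg hs]
    calc s * |phi p b| ≤ √α * (1 / √α) :=
          mul_le_mul hsα (abs_phi_le hα hp b) (abs_nonneg _) (Real.sqrt_nonneg _)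
      _ = 1 := mul_one_div_cancel (Real.sqrt_pos.2 hα).ne'
  have hnn : ∀ᵐ p ∂arcsineLaw α (1 - α), 0 ≤ 1 - s * h p + K := by
    filter_upwards [hpt, ae_arcsineLaw α] with p hp hp'
    refine le_trans (Finset.sum_nonneg fun c _ => mul_nonneg (prod_bern_nonneg ?_ c)
      (Real.exp_pos _).le) hp
    exact ⟨by linarith [hp'.1], by linarith [hp'.2]⟩
  have hi1 : Integrable (fun p => s * h p) (arcsineLaw α (1 - α)) := hint.const_mul s
  have hi2 : Integrable (fun p => 1 - s * h p) (arcsineLaw α (1 - α)) :=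
    (integrable_const 1).sub hi1
  have hint' : Integrable (fun p => 1 - s * h p + K) (arcsineLaw α (1 - α)) :=
    hi2.add (integrable_const K)
  refine ⟨∫ p, (1 - s * h p + K) ∂arcsineLaw α (1 - α), integral_nonneg_of_ae hnn, ?_, ?_⟩
  · rw [integral_add hi2 (integrable_const K), integral_sub (integrable_const 1) hi1,
      integral_const_mul, show ∫ p, h p ∂arcsineLaw α (1 - α) = _ from hval]
    simp only [integral_const, probReal_univ, one_smul]
    have hb := le_sum_prod_bern_sub ⟨hα.le, by linarith⟩ hn f
    have := mul_le_mul_of_nonneg_left (div_le_div_of_nonneg_right hb hM.le) hs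
    linarith
  · rw [ofReal_integral_eq_lintegral_ofReal hint' hnn]
    refine lintegral_mono_ae ?_
    filter_upwards [hpt] with p hp
    exact ENNReal.ofReal_le_ofReal hp

/-! ### Gain of the coalition in one round -/

/-- The contribution of round `j` to the total score of the remaining coalition, plus `γ` if the
column is constant by the choice of the bias and the answer is inconsistent with it. -/
def gain (γ σ : ℝ) (S : Finset (Fin N)) (ω : Tape N ℓ) (a : Fin ℓ → Bool) (j : Fin ℓ) : ℝ :=
  ∑ i ∈ remaining σ S ω a j, sign (a j) * phi (ω.1 j) (entry ω j i) +
    if (ω.1 j = 0 ∨ ω.1 j = 1) ∧ ∀ i, a j ≠ entry ω j i then γ else 0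

lemma ae_pi_lt_one :
    ∀ᵐ u : Fin N → unitInterval ∂(Measure.pi fun _ => volume), ∀ i, (u i : ℝ) < 1 := by
  rw [ae_all_iff]
  intro i
  have h : ∀ᵐ y : unitInterval, (y : ℝ) < 1 := by
    filter_upwards [Measure.ae_ne volume (1 : unitInterval)] with y hy
    exact lt_of_le_of_ne y.2.2 fun h => hy (Subtype.ext h)
  exact (measurePreserving_eval (fun _ : Fin N => (volume : Measure unitInterval))
    i).quasiMeasurePreserving.ae h

lemma exp_neg_mul_le {x : ℝ} (h0 : 0 ≤ x) (h1 : x ≤ 1) (b : Prop) [Decidable b] :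
    Real.exp (-(if b then x else 0)) ≤ 1 - (if b then x else 0) + x ^ 2 := by
  split_ifs
  · have := (abs_le.1 (Real.abs_exp_sub_one_sub_id_le (x := -x)
      (by rwa [abs_neg, abs_of_nonneg h0]))).2
    rw [neg_sq] at this
    linarith
  · simp [sq_nonneg]

section

variable {α σ s γ : ℝ} {S : Finset (Fin N)} {a : Tape N ℓ → Fin ℓ → Bool}

/-- The exponential moment of the gain in one round, given the earlier rounds. -/
lemma IsCausal.lintegral_exp_neg_gain_le (ha : IsCausal σ S a) (hS : S.card ≤ n) (hn : 1 ≤ n)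
    {κ ζ : ℝ} (hκ : 0 < κ) (hκ' : κ ≤ 1 / 2) (hζ : ζ = (1 - κ) / 2) (hα : 0 < α)
    (hα' : α ≤ 1 / 4) (hγ : γ = 2 * κ / (arcsineMass α * ζ)) (hs : 0 ≤ s) (hs4 : s ≤ 1 / 4)
    (hsα : s ≤ √α) (hsn : n * s ^ 2 ≤ 1) (ω : Tape N ℓ) (j : Fin ℓ) :
    ∫⁻ p, ∫⁻ u, ENNReal.ofReal (Real.exp (-(s * gain γ σ S (refresh ω j p u)
      (a (refresh ω j p u)) j))) ∂(Measure.pi fun _ => volume) ∂biasLaw α ζ ≤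
    ENNReal.ofReal (Real.exp (-(s * (2 * κ / arcsineMass α * (1 - 2 * α * n)))
      + 20 * κ * n * s ^ 2)) := by
  classical
  set T := remaining σ S ω (a ω) j with hT
  have hcard : Fintype.card T ≤ n := by
    rw [Fintype.card_coe]
    exact (Finset.card_le_card (Finset.filter_subset _ _)).trans hS
  -- The answer as a function of the visible bits, realised with bias 1/2: the number 0 gives the
  -- bit +1 and the number 1 gives −1.
  set f : (T → Bool) → Bool := fun c => a (refresh ω j (1 / 2)
    fun i => if h : i ∈ T then (if c ⟨i, h⟩ then 0 else 1) else 0) j with hf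
  have hans : ∀ p u, a (refresh ω j p u) j = f fun i => decide ((u i : ℝ) < p) := by
    intro p u
    refine ha.refresh_self_congr ω j fun i hi => ?_
    rw [dif_pos hi]
    by_cases h : (u i : ℝ) < p
    · simp [h]
    · simp [h]; norm_num
  have hgain : ∀ p u, gain γ σ S (refresh ω j p u) (a (refresh ω j p u)) j =
      ∑ i : T, sign (f fun i => decide ((u i : ℝ) < p)) * phi p (decide ((u i : ℝ) < p)) +
      if (p = 0 ∨ p = 1) ∧ ∀ i, f (fun i => decide ((u i : ℝ) < p)) ≠ decide ((u i : ℝ) < p)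
        then γ else 0 := by
    intro p u
    unfold gain
    rw [ha.remaining_refresh ω le_rfl]
    simp only [hans, refresh_fst_self, entry_refresh_self]
    rw [← Finset.sum_coe_sort]
  have hM1 := one_le_arcsineMass hα hα'
  have hM : 0 < arcsineMass α := by linarith
  have hζ4 : 1 / 4 ≤ ζ := by rw [hζ]; linarith
  have hγ0 : 0 ≤ γ := by rw [hγ]; positivity
  have hγ8 : γ ≤ 8 * κ := by
    rw [hγ, div_le_iff₀ (by positivity)]
    nlinarith [mul_le_mul hM1 hζ4 (by norm_num) hM.le]
  -- The balance that defines γ: the expected reward on one constant column equals the drift lost by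
  -- answering it inconsistently.
  have hζγ : ζ * γ = 2 * κ / arcsineMass α := by
    rw [hγ]
    have : ζ ≠ 0 := by linarith
    field_simp
  have hsγ0 : 0 ≤ s * γ := mul_nonneg hs hγ0
  have hsγ1 : s * γ ≤ 1 := by nlinarith
  obtain ⟨A, hA0, hA, hAint⟩ := lintegral_arcsineLaw_exp_le hα hα' hs hsα hcard f
  have hE0 : ∫⁻ u, ENNReal.ofReal (Real.exp (-(s * gain γ σ S (refresh ω j 0 u)
      (a (refresh ω j 0 u)) j))) ∂(Measure.pi fun _ => volume) ≤ ENNReal.ofReal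
      (Real.exp (-(if f (fun _ => false) = true then s * γ else 0))) := by
    calc _ ≤ ∫⁻ _u : Fin N → unitInterval, ENNReal.ofReal
          (Real.exp (-(if f (fun _ => false) = true then s * γ else 0)))
          ∂(Measure.pi fun _ => volume) := by
          refine lintegral_mono fun u => ENNReal.ofReal_le_ofReal (Real.exp_le_exp.2
            (neg_le_neg ?_))
          have hd : ∀ i, decide ((u i : ℝ) < 0) = false := fun i => by simpa using (u i).2.1
          rw [hgain]
          have hφ : phi 0 false = 0 := by simp [phi]
          simp only [hd, hφ, mul_zero, Finset.sum_const_zero, zero_add]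
          by_cases hb : f (fun _ => false) = true
          · rw [if_pos hb, if_pos ⟨by simp, fun _ => by rw [hb]; decide⟩]
          · rw [if_neg hb]
            split_ifs
            · exact hsγ0
            · simp
      _ = _ := by simp
  have hE1 : ∫⁻ u, ENNReal.ofReal (Real.exp (-(s * gain γ σ S (refresh ω j 1 u)
      (a (refresh ω j 1 u)) j))) ∂(Measure.pi fun _ => volume) ≤ ENNReal.ofReal
      (Real.exp (-(if f (fun _ => true) = false then s * γ else 0))) := by
    calc _ ≤ ∫⁻ _u : Fin N → unitInterval, ENNReal.ofReal
          (Real.exp (-(if f (fun _ => true) = false then s * γ else 0)))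
          ∂(Measure.pi fun _ => volume) := by
          refine lintegral_mono_ae ?_
          -- At bias 1 the column is constant only almost surely, since the number 1 itself would
          -- give −1.
          filter_upwards [ae_pi_lt_one] with u hu
          refine ENNReal.ofReal_le_ofReal (Real.exp_le_exp.2 (neg_le_neg ?_))
          have hd : ∀ i, decide ((u i : ℝ) < 1) = true := fun i => by simpa using hu i
          rw [hgain]
          have hφ : phi 1 true = 0 := by simp [phi]
          simp only [hd, hφ, mul_zero, Finset.sum_const_zero, zero_add]
          by_cases hb : f (fun _ => true) = false
          · rw [if_pos hb, if_pos ⟨by simp, fun _ => by rw [hb]; decide⟩]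
          · rw [if_neg hb]
            split_ifs
            · exact hsγ0
            · simp
      _ = _ := by simp
  have hmid : ∫⁻ p, ∫⁻ u, ENNReal.ofReal (Real.exp (-(s * gain γ σ S (refresh ω j p u)
      (a (refresh ω j p u)) j))) ∂(Measure.pi fun _ => volume) ∂arcsineLaw α (1 - α) ≤
      ENNReal.ofReal A := by
    refine le_trans (lintegral_mono_ae ?_) hAint
    filter_upwards [ae_arcsineLaw α] with p hp
    have hp' : p ∈ Set.Icc (0 : ℝ) 1 := ⟨by linarith [hp.1], by linarith [hp.2]⟩
    have hp01 : ¬ (p = 0 ∨ p = 1) := by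
      rintro (h | h) <;> linarith [hp.1, hp.2]
    simp only [hgain, hp01, false_and, if_false, add_zero]
    rw [lintegral_pi_decide_lt hp' T fun c => ENNReal.ofReal (Real.exp (-(s *
      ∑ i : T, sign (f c) * phi p (c i)))), ENNReal.ofReal_sum_of_nonneg fun c _ =>
      mul_nonneg (prod_bern_nonneg hp' c) (Real.exp_pos _).le]
    refine Finset.sum_le_sum fun c _ => ?_
    rw [ENNReal.ofReal_mul (prod_bern_nonneg hp' c)]
  rw [lintegral_biasLaw]
  have hκζ : 1 - 2 * ζ = κ := by rw [hζ]; ring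
  rw [hκζ]
  set E0 := Real.exp (-(if f (fun _ => false) = true then s * γ else 0)) with hE0d
  set E1 := Real.exp (-(if f (fun _ => true) = false then s * γ else 0)) with hE1d
  have hζ0 : 0 ≤ ζ := by linarith
  calc _ ≤ ENNReal.ofReal κ * ENNReal.ofReal A +
        (ENNReal.ofReal ζ * ENNReal.ofReal E0 + ENNReal.ofReal ζ * ENNReal.ofReal E1) := by
        gcongr
    _ = ENNReal.ofReal (κ * A + (ζ * E0 + ζ * E1)) := by
        rw [ENNReal.ofReal_add (by positivity) (by positivity), ENNReal.ofReal_add (by positivity)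
          (by positivity), ENNReal.ofReal_mul hκ.le, ENNReal.ofReal_mul hζ0,
          ENNReal.ofReal_mul hζ0]
    _ ≤ _ := by
        refine ENNReal.ofReal_le_ofReal (le_trans ?_ (Real.add_one_le_exp _))
        have h0 := exp_neg_mul_le hsγ0 hsγ1 (f (fun _ => false) = true)
        have h1 := exp_neg_mul_le hsγ0 hsγ1 (f (fun _ => true) = false)
        rw [← hE0d] at h0
        rw [← hE1d] at h1
        have hexp : Real.exp (n * s ^ 2) - 1 ≤ 2 * (n * s ^ 2) := by
          have hx : (0 : ℝ) ≤ n * s ^ 2 := by positivity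
          have := (abs_le.1 (Real.abs_exp_sub_one_le (x := n * s ^ 2)
            (by rwa [abs_of_nonneg hx]))).2
          rwa [abs_of_nonneg hx] at this
        -- The two indicators record inconsistency on the columns −1 and +1. They cancel below
        -- against the rewards (`e4` and `e7`), so the drift does not depend on the strategy.
        have hsum : sign (f fun _ => true) - sign (f fun _ => false) =
            2 * (1 - (if f (fun _ => false) = true then 1 else 0)
              - if f (fun _ => true) = false then 1 else 0) := by
          cases f (fun _ => true) <;> cases f (fun _ => false) <;> norm_num [sign]
        have hi0 : (if f (fun _ => false) = true then s * γ else 0) =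
            s * γ * if f (fun _ => false) = true then 1 else 0 := by simp
        have hi1 : (if f (fun _ => true) = false then s * γ else 0) =
            s * γ * if f (fun _ => true) = false then 1 else 0 := by simp
        rw [hi0] at h0
        rw [hi1] at h1
        rw [hsum] at hA
        set b0 : ℝ := if f (fun _ => false) = true then 1 else 0
        set b1 : ℝ := if f (fun _ => true) = false then 1 else 0
        have e1 : κ * A ≤ κ * (1 - s * ((2 * (1 - b0 - b1) - 4 * α * n) / arcsineMass α)
            + 2 * (2 * (n * s ^ 2))) :=
          mul_le_mul_of_nonneg_left (hA.trans (by linarith)) hκ.le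
        have e2 := mul_le_mul_of_nonneg_left h0 hζ0
        have e3 := mul_le_mul_of_nonneg_left h1 hζ0
        have e4 : ζ * (s * γ * b0) + ζ * (s * γ * b1) =
            s * (2 * κ / arcsineMass α) * (b0 + b1) := by
          rw [← hζγ]; ring
        have e5 : ζ * (s * γ) ^ 2 ≤ 8 * κ * s ^ 2 := by
          have h2 : ζ * γ ≤ 2 * κ := by
            rw [hζγ, div_le_iff₀ hM]
            nlinarith
          have h3 : ζ * γ * γ ≤ 2 * κ * 4 :=
            mul_le_mul h2 (by linarith) hγ0 (by linarith)
          nlinarith [mul_le_mul_of_nonneg_right h3 (sq_nonneg s)]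
        have e6 : κ * s ^ 2 ≤ κ * s ^ 2 * n :=
          le_mul_of_one_le_right (by positivity) (by exact_mod_cast hn)
        have e7 : κ * (s * ((2 * (1 - b0 - b1) - 4 * α * n) / arcsineMass α)) =
            s * (2 * κ / arcsineMass α * (1 - 2 * α * n)) -
              s * (2 * κ / arcsineMass α) * (b0 + b1) := by
          ring
        have e8 : κ + 2 * ζ = 1 := by linarith
        -- The second-order terms add up to 20κns²: 4κns² from the arcsine part (`hexp`), and 8κs²
        -- from each of the two constant columns (`e5`).
        linarith

end

/-! ### Total gain: pointwise upper bound and Chernoff estimate -/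

lemma sum_Iio_le {x : Fin ℓ → ℝ} {σ : ℝ} (hσ : 0 ≤ σ) {j : Fin ℓ}
    (h : ∀ k < j, ∑ l ∈ Finset.Iic k, x l ≤ σ) : ∑ l ∈ Finset.Iio j, x l ≤ σ := by
  rcases (Finset.Iio j).eq_empty_or_nonempty with he | hne
  · rw [he, Finset.sum_empty]
    exact hσ
  · have hm := Finset.max'_mem _ hne
    have : Finset.Iio j = Finset.Iic ((Finset.Iio j).max' hne) := by
      ext l
      constructor
      · exact fun hl => Finset.mem_Iic.2 (Finset.le_max' _ _ hl)
      · exact fun hl => Finset.mem_Iio.2 ((Finset.mem_Iic.1 hl).trans_lt (Finset.mem_Iio.1 hm))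
    rw [this]
    exact h _ (Finset.mem_Iio.1 hm)

/-- Partial sums with steps at most `M`, stopped when they first exceed `σ`, are at most
`σ + M`. -/
lemma sum_stopped_le {x : Fin ℓ → ℝ} {σ M : ℝ} (hσ : 0 ≤ σ) (hM : 0 ≤ M) (hx : ∀ j, x j ≤ M) :
    ∑ j with ∀ k < j, ∑ l ∈ Finset.Iic k, x l ≤ σ, x j ≤ σ + M := by
  classical
  set D : Finset (Fin ℓ) := Finset.univ.filter fun j => ∀ k < j, ∑ l ∈ Finset.Iic k, x l ≤ σ
    with hD
  rcases D.eq_empty_or_nonempty with he | hne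
  · rw [he, Finset.sum_empty]
    linarith
  · have hm := Finset.max'_mem _ hne
    have hm' := (Finset.mem_filter.1 hm).2
    have : D = insert (D.max' hne) (Finset.Iio (D.max' hne)) := by
      ext l
      rw [Finset.Iio_insert, Finset.mem_Iic]
      constructor
      · exact fun hl => Finset.le_max' _ _ hl
      · exact fun hl => Finset.mem_filter.2 ⟨Finset.mem_univ _, fun k hk =>
          hm' k (hk.trans_le hl)⟩
    rw [this, Finset.sum_insert Finset.notMem_Iio_self]
    linarith [sum_Iio_le hσ hm', hx (D.max' hne)]

/-- After exchanging the sums, each guilty user contributes a score stopped just after it first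
exceeds σ; the overshoot is at most one step. -/
lemma sum_remaining_le {σ M : ℝ} (hσ : 0 ≤ σ) (hM : 0 ≤ M) (S : Finset (Fin N)) (ω : Tape N ℓ)
    (a : Fin ℓ → Bool) (hω : ∀ j b, |phi (ω.1 j) b| ≤ M) :
    ∑ j, ∑ i ∈ remaining σ S ω a j, sign (a j) * phi (ω.1 j) (entry ω j i) ≤
      S.card * (σ + M) := by
  classical
  have h1 : ∑ j, ∑ i ∈ remaining σ S ω a j, sign (a j) * phi (ω.1 j) (entry ω j i) =
      ∑ i ∈ S, ∑ j with ∀ k < j, cumScore ω a k i ≤ σ,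
        sign (a j) * phi (ω.1 j) (entry ω j i) := by
    simp only [remaining, Finset.sum_filter]
    exact Finset.sum_comm
  rw [h1, ← nsmul_eq_mul]
  refine Finset.sum_le_card_nsmul _ _ _ fun i _ => ?_
  refine sum_stopped_le (x := fun j => sign (a j) * phi (ω.1 j) (entry ω j i)) hσ hM fun j => ?_
  refine (le_abs_self _).trans ?_
  rw [abs_mul, abs_sign, one_mul]
  exact hω j _

lemma sum_gain_le {γ σ M : ℝ} (hγ : 0 ≤ γ) (hσ : 0 ≤ σ) (hM : 0 ≤ M) (S : Finset (Fin N))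
    (ω : Tape N ℓ) (a : Fin ℓ → Bool) (hω : ∀ j b, |phi (ω.1 j) b| ≤ M) :
    ∑ j, gain γ σ S ω a j ≤ S.card * (σ + M) +
      γ * (Finset.univ.filter fun j => ¬ ∃ i, a j = entry ω j i).card := by
  unfold gain
  rw [Finset.sum_add_distrib]
  refine add_le_add (sum_remaining_le hσ hM S ω a hω) ?_
  rw [← Finset.sum_filter, Finset.sum_const, nsmul_eq_mul, mul_comm]
  gcongr with j
  rintro ⟨_, h⟩ ⟨i, hi⟩
  exact h i hi

lemma ae_tapeLaw {ν : Measure ℝ} [IsProbabilityMeasure ν] {Q : ℝ → Prop} (h : ∀ᵐ p ∂ν, Q p) :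
    ∀ᵐ ω ∂tapeLaw N ℓ ν, ∀ j, Q (ω.1 j) := by
  rw [ae_all_iff]
  intro j
  exact ((measurePreserving_eval (fun _ : Fin ℓ => ν) j).quasiMeasurePreserving.comp
    Measure.quasiMeasurePreserving_fst).ae h

section

variable {γ σ : ℝ} {S : Finset (Fin N)} {a : Tape N ℓ → Fin ℓ → Bool}

lemma IsCausal.measurable_gain (ha : IsCausal σ S a) (γ : ℝ) (j : Fin ℓ) :
    Measurable fun ω => gain γ σ S ω (a ω) j := by
  classical
  unfold gain
  simp only [remaining, Finset.sum_filter]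
  refine Measurable.add ?_ (Measurable.ite ?_ measurable_const measurable_const)
  · refine Finset.measurable_sum _ fun i _ => Measurable.ite ?_ ?_ measurable_const
    · simp only [Set.ofPred_forall]
      exact MeasurableSet.iInter fun k => MeasurableSet.iInter fun _ =>
        measurableSet_le (ha.measurable_cumScore k i) measurable_const
    · refine Measurable.mul ?_ ?_
      · exact (measurable_of_finite sign).comp (ha.measurable j)
      · exact measurable_phi.comp (Measurable.prodMk (by fun_prop) (measurable_entry j i))
  · have hp : Measurable fun ω : Tape N ℓ => ω.1 j := by fun_prop
    have hne : MeasurableSet {ω : Tape N ℓ | ∀ i, a ω j ≠ entry ω j i} := by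
      simp only [Set.ofPred_forall]
      exact MeasurableSet.iInter fun i =>
        (measurableSet_eq_fun (ha.measurable j) (measurable_entry j i)).compl
    exact ((hp (measurableSet_singleton 0)).union (hp (measurableSet_singleton 1))).inter hne

lemma IsCausal.gain_refresh_of_lt (ha : IsCausal σ S a) (ω : Tape N ℓ) {j k : Fin ℓ} (hk : k < j)
    (p : ℝ) (u : Fin N → unitInterval) :
    gain γ σ S (refresh ω j p u) (a (refresh ω j p u)) k = gain γ σ S ω (a ω) k := by
  unfold gain
  simp only [ha.remaining_refresh ω hk.le, ha.refresh_of_lt ω hk, refresh_fst_of_lt ω hk,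
    entry_refresh_of_lt ω hk]

/-- The adversary is consistent in all but few rounds with small probability only. -/
lemma IsCausal.measure_inconsistencies_le (ha : IsCausal σ S a) {ν : Measure ℝ}
    [IsProbabilityMeasure ν] {s M t b : ℝ} (hs : 0 ≤ s) (hγ : 0 ≤ γ) (hσ : 0 ≤ σ) (hM : 0 ≤ M)
    (hν : ∀ᵐ p ∂ν, ∀ b, |phi p b| ≤ M)
    (hB : ∀ ω j, ∫⁻ p, ∫⁻ u, ENNReal.ofReal (Real.exp (-(s * gain γ σ S (refresh ω j p u)
      (a (refresh ω j p u)) j))) ∂(Measure.pi fun _ => volume) ∂ν ≤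
        ENNReal.ofReal (Real.exp b)) :
    tapeLaw N ℓ ν {ω | ((Finset.univ.filter fun j => ¬ ∃ i, a ω j = entry ω j i).card : ℝ) ≤ t} ≤
      ENNReal.ofReal (Real.exp (s * (S.card * (σ + M) + γ * t) + ℓ * b)) := by
  set Q := s * (S.card * (σ + M) + γ * t) with hQ
  set G : Fin ℓ → Tape N ℓ → ℝ≥0∞ := fun j ω =>
    ENNReal.ofReal (Real.exp (-(s * gain γ σ S ω (a ω) j))) with hG
  have hGm : ∀ j, Measurable (G j) := fun j =>
    (Real.measurable_exp.comp ((ha.measurable_gain γ j).const_mul s).neg).ennreal_ofReal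
  have hint : ∫⁻ ω, ∏ j, G j ω ∂tapeLaw N ℓ ν ≤ ENNReal.ofReal (Real.exp b) ^ ℓ :=
    lintegral_tapeLaw_prod_le ν G _ hGm
      (fun j k hk ω p u => by simp only [hG, ha.gain_refresh_of_lt ω hk])
      (fun j ω => hB ω j)
  have hsub : ∀ᵐ ω ∂tapeLaw N ℓ ν,
      ((Finset.univ.filter fun j => ¬ ∃ i, a ω j = entry ω j i).card : ℝ) ≤ t →
      ENNReal.ofReal (Real.exp (-Q)) ≤ ∏ j, G j ω := by
    filter_upwards [ae_tapeLaw (N := N) (ℓ := ℓ) hν] with ω hω ht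
    have h1 := sum_gain_le hγ hσ hM S ω (a ω) hω
    have h2 := mul_le_mul_of_nonneg_left ht hγ
    rw [hG, ← ENNReal.ofReal_prod_of_nonneg fun j _ => (Real.exp_pos _).le, ← Real.exp_sum,
      Finset.sum_neg_distrib, ← Finset.mul_sum]
    refine ENNReal.ofReal_le_ofReal (Real.exp_le_exp.2 (neg_le_neg ?_))
    exact mul_le_mul_of_nonneg_left (by linarith) hs
  have hmarkov := mul_meas_ge_le_lintegral (μ := tapeLaw N ℓ ν)
    (Finset.measurable_prod Finset.univ fun j _ => hGm j) (ENNReal.ofReal (Real.exp (-Q)))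
  calc tapeLaw N ℓ ν
        {ω | ((Finset.univ.filter fun j => ¬ ∃ i, a ω j = entry ω j i).card : ℝ) ≤ t}
      ≤ tapeLaw N ℓ ν {ω | ENNReal.ofReal (Real.exp (-Q)) ≤ ∏ j, G j ω} :=
        measure_mono_ae hsub
    _ = ENNReal.ofReal (Real.exp Q) * (ENNReal.ofReal (Real.exp (-Q)) *
          tapeLaw N ℓ ν {ω | ENNReal.ofReal (Real.exp (-Q)) ≤ ∏ j, G j ω}) := by
        rw [← mul_assoc, ← ENNReal.ofReal_mul (Real.exp_pos _).le, ← Real.exp_add, add_neg_cancel,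
          Real.exp_zero, ENNReal.ofReal_one, one_mul]
    _ ≤ ENNReal.ofReal (Real.exp Q) * ENNReal.ofReal (Real.exp b) ^ ℓ := by
        gcongr
        exact hmarkov.trans hint
    _ = ENNReal.ofReal (Real.exp (Q + ℓ * b)) := by
        rw [← ENNReal.ofReal_pow (Real.exp_pos _).le, ← ENNReal.ofReal_mul (Real.exp_pos _).le,
          ← Real.exp_nat_mul, ← Real.exp_add]

end

/-! ### Choice of parameters -/

/-- The exponent in the bound for the probability of few inconsistencies is negative. -/
lemma exponent_le {n ℓ β κ L ζ α σ Z γ s : ℝ} (hn : 1 ≤ n) (hβ : 0 ≤ β) (hκ : κ = 1 / 2 - β)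
    (hκ0 : 0 < κ) (hL : 1 / 2 ≤ L) (hζ : ζ = (1 - κ) / 2) (hα0 : 0 < α) (hα1 : α ≤ 1)
    (hα : α = κ / (8 * n)) (hσ2 : σ ^ 2 = 8 * ℓ * L) (hℓ0 : 0 < ℓ)
    (hℓ : 2048 * (n ^ 2 * L) ≤ ℓ * κ ^ 4) (hZ0 : 0 < Z) (hZ4 : Z ≤ 4)
    (hγ : γ = 2 * κ / (Z * ζ)) (hs : s = κ / (200 * n)) :
    s * (n * (σ + 1 / √α) + γ * (β * ℓ)) +
      ℓ * (-(s * (2 * κ / Z * (1 - 2 * α * n))) + 20 * κ * n * s ^ 2) ≤ -(κ * n * L) := by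
  have hn0 : 0 < n := by linarith
  have hL0 : 0 < L := by linarith
  have hκ2 : κ ≤ 1 / 2 := by linarith
  have hζ0 : 0 < ζ := by linarith
  have hγ0 : 0 ≤ γ := by rw [hγ]; positivity
  have hs0 : 0 ≤ s := by rw [hs]; positivity
  have hsn : s * (200 * n) = κ := by rw [hs]; field_simp
  have hα8 : α * (8 * n) = κ := by rw [hα]; field_simp
  -- The point is β = 1/2 − κ ≤ (1−κ)²/2 = (1−κ)ζ. With 2αn = κ/4 the surplus is (2κ/Z)(3κ/4), and Z
  -- ≤ 4.
  have hdrift : 3 / 8 * κ ^ 2 ≤ 2 * κ / Z * (1 - 2 * α * n) - γ * β := by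
    have h1 : γ * ζ = 2 * κ / Z := by
      rw [hγ]; field_simp
    have h2 : β ≤ (1 - κ) * ζ := by
      rw [hζ]; linarith [sq_nonneg κ]
    have h3 : γ * β ≤ 2 * κ / Z * (1 - κ) := by
      rw [← h1]
      calc γ * β ≤ γ * ((1 - κ) * ζ) := mul_le_mul_of_nonneg_left h2 hγ0
        _ = γ * ζ * (1 - κ) := by ring
    have h4 : κ / 2 ≤ 2 * κ / Z := by
      rw [div_le_div_iff₀ two_pos hZ0]
      linarith [mul_le_mul_of_nonneg_left hZ4 hκ0.le]
    have h5 : 2 * α * n = κ / 4 := by linarith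
    rw [h5]
    linarith [mul_le_mul_of_nonneg_right h4 (show 0 ≤ 3 / 4 * κ by positivity)]
  -- Squaring turns this into 8 · 256 · n²L ≤ ℓκ⁴, the source of the constant 2048.
  have hnσ : n * σ ≤ κ ^ 2 * ℓ / 16 := by
    refine le_of_sq_le_sq ?_ (by positivity)
    rw [mul_pow, hσ2]
    linarith [mul_le_mul_of_nonneg_left hℓ hℓ0.le]
  have hnM : n * (1 / √α) ≤ κ ^ 2 * ℓ / 16 := by
    have h1 : 1 / √α ≤ 1 / α := by
      refine one_div_le_one_div_of_le hα0 ?_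
      exact Real.le_sqrt_of_sq_le (pow_le_of_le_one hα0.le hα1 two_ne_zero)
    have h2 : 1 / α = 8 * n / κ := by rw [hα, one_div_div]
    have h3 : n * (8 * n / κ) ≤ κ ^ 2 * ℓ / 16 := by
      rw [mul_div_assoc', div_le_iff₀ hκ0]
      have h4 : ℓ * κ ^ 4 ≤ ℓ * κ ^ 3 := by
        refine mul_le_mul_of_nonneg_left ?_ hℓ0.le
        exact pow_le_pow_of_le_one hκ0.le (by linarith) (by norm_num)
      linarith [mul_le_mul_of_nonneg_left hL (sq_nonneg n), sq_nonneg n]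
    calc n * (1 / √α) ≤ n * (8 * n / κ) := by
          rw [← h2]
          exact mul_le_mul_of_nonneg_left h1 hn0.le
      _ ≤ _ := h3
  -- The surplus left is 3/8 − 1/16 − 1/16 − 1/10 = 3/20; the term 1/10 is the second-order error at
  -- s = κ/(200n).
  have hmain : s * (n * (σ + 1 / √α) + γ * (β * ℓ)) +
      ℓ * (-(s * (2 * κ / Z * (1 - 2 * α * n))) + 20 * κ * n * s ^ 2) ≤
      -(s * (3 / 20 * κ ^ 2 * ℓ)) := by
    have h1 : 20 * κ * n * s ^ 2 = s * (κ ^ 2 / 10) := by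
      calc 20 * κ * n * s ^ 2 = s * (κ * (s * (200 * n)) / 10) := by ring
        _ = s * (κ ^ 2 / 10) := by rw [hsn]; ring
    have h2 := mul_le_mul_of_nonneg_left hdrift hℓ0.le
    have h3 : n * (σ + 1 / √α) + γ * (β * ℓ) +
        ℓ * (-(2 * κ / Z * (1 - 2 * α * n)) + κ ^ 2 / 10) ≤ -(3 / 20 * κ ^ 2 * ℓ) := by
      linarith
    rw [h1]
    have h4 := mul_le_mul_of_nonneg_left h3 hs0
    linarith
  have hend : κ * n * L ≤ s * (3 / 20 * κ ^ 2 * ℓ) := by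
    have h1 : s * (3 / 20 * κ ^ 2 * ℓ) * (200 * n) = 3 / 20 * κ ^ 3 * ℓ := by
      calc _ = s * (200 * n) * (3 / 20 * κ ^ 2 * ℓ) := by ring
        _ = 3 / 20 * κ ^ 3 * ℓ := by rw [hsn]; ring
    have h2 : κ * n * L * (200 * n) ≤ 3 / 20 * κ ^ 3 * ℓ := by
      have h3 : ℓ * κ ^ 4 ≤ ℓ * κ ^ 3 * (1 / 2) := by
        linarith [mul_le_mul_of_nonneg_left hκ2 (show 0 ≤ ℓ * κ ^ 3 by positivity)]
      have h4 : κ * (n ^ 2 * L) ≤ 1 / 2 * (n ^ 2 * L) :=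
        mul_le_mul_of_nonneg_right hκ2 (by positivity)
      calc κ * n * L * (200 * n) = 200 * (κ * (n ^ 2 * L)) := by ring
        _ ≤ 3 / 20 * (ℓ * κ ^ 3) := by
          linarith [show 0 ≤ ℓ * κ ^ 3 by positivity]
        _ = 3 / 20 * κ ^ 3 * ℓ := by ring
    rw [← h1] at h2
    exact le_of_mul_le_mul_right h2 (by positivity)
  exact hmain.trans (neg_le_neg hend)

section

variable {β δ κ L ζ α σ : ℝ} {S : Finset (Fin N)} {a : Tape N ℓ → Fin ℓ → Bool}

lemma IsCausal.measure_falselyAccused_le_of_length (ha : IsCausal σ S a)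
    [IsProbabilityMeasure (biasLaw α ζ)] (hn : (1 : ℝ) ≤ n) (hκ0 : 0 < κ) (hκ1 : κ ≤ 1)
    (hδ : 0 < δ) (hδ1 : δ ≤ 1) (hL0 : 0 < L) (hδL : Real.exp (-L) = δ / 2) (hα0 : 0 < α)
    (hα : α = κ / (8 * n)) (hσ0 : 0 ≤ σ) (hσ2 : σ ^ 2 = 8 * ℓ * L) (hℓ0 : (0 : ℝ) < ℓ)
    (hℓ : 2048 * ((n : ℝ) ^ 2 * L) ≤ ℓ * κ ^ 4) :
    tapeLaw N ℓ (biasLaw α ζ)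
      {ω | δ * (Sᶜ.card : ℝ) < ((falselyAccused σ S ω (a ω)).card : ℝ)} ≤
      ENNReal.ofReal (min (δ * Sᶜ.card) ((2 : ℝ) ^ (-(1 / 2 * (δ * Sᶜ.card))))) := by
  have hn0 : (0 : ℝ) < n := by linarith
  have hαs : 0 < √α := Real.sqrt_pos.2 hα0
  have hsσ : σ / (2 * ℓ) * σ - ℓ * (σ / (2 * ℓ)) ^ 2 = 2 * L := by
    have : σ / (2 * ℓ) * σ - ℓ * (σ / (2 * ℓ)) ^ 2 = σ ^ 2 / (4 * ℓ) := by
      field_simp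
      ring
    rw [this, hσ2]
    field_simp
    ring
  -- This s maximises sσ − ℓs²; the maximum 2L gives (δ/2)² ≤ δ/4.
  refine ha.measure_falselyAccused_le (s := σ / (2 * ℓ)) (by positivity) hδ.le ?_ _ ?_
  · rw [hsσ, show -(2 * L) = -L + -L by ring, Real.exp_add, hδL]
    linarith [mul_le_mul_of_nonneg_left hδ1 hδ.le]
  · filter_upwards [ae_biasLaw_abs_phi_le hα0 ζ] with p hp
    refine ⟨hp.1, fun b => ?_⟩
    have hle : σ / (2 * ℓ) ≤ √α := by
      refine Real.le_sqrt_of_sq_le ?_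
      rw [div_pow, hσ2, hα, div_le_div_iff₀ (by positivity) (by positivity)]
      have h1 : 16 * (n * L) ≤ ℓ * κ := by
        have h2 : κ ^ 4 ≤ κ := pow_le_of_le_one hκ0.le hκ1 (by norm_num)
        linarith [mul_le_mul_of_nonneg_left h2 hℓ0.le,
          mul_le_mul_of_nonneg_right hn (mul_pos hn0 hL0).le, mul_pos hn0 hL0]
      linarith [mul_le_mul_of_nonneg_left h1 hℓ0.le]
    rw [abs_mul, abs_of_nonneg (show 0 ≤ σ / (2 * ℓ) by positivity)]
    calc σ / (2 * ℓ) * |phi p b| ≤ √α * (1 / √α) :=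
          mul_le_mul hle (hp.2 b) (abs_nonneg _) hαs.le
      _ = 1 := mul_one_div_cancel hαs.ne'

lemma IsCausal.measure_inconsistencies_le_of_length (ha : IsCausal σ S a)
    [IsProbabilityMeasure (biasLaw α ζ)] (hS : S.card = n) (hn : 1 ≤ n) (hβ : 0 ≤ β)
    (hκ : κ = 1 / 2 - β) (hκ0 : 0 < κ) (hδ : 0 < δ) (hL : 1 / 2 ≤ L)
    (hδL : Real.exp (-L) = δ / 2) (hζ : ζ = (1 - κ) / 2) (hα0 : 0 < α) (hα16 : α ≤ 1 / 16)
    (hα : α = κ / (8 * n)) (hσ0 : 0 ≤ σ) (hσ2 : σ ^ 2 = 8 * ℓ * L) (hℓ0 : (0 : ℝ) < ℓ)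
    (hℓ : 2048 * ((n : ℝ) ^ 2 * L) ≤ ℓ * κ ^ 4) :
    tapeLaw N ℓ (biasLaw α ζ)
      {ω | ((Finset.univ.filter fun j => ¬ ∃ i, a ω j = entry ω j i).card : ℝ) ≤ β * ℓ} ≤
      ENNReal.ofReal (δ ^ (1 / 2 * (κ * n))) := by
  have hn1 : (1 : ℝ) ≤ n := by exact_mod_cast hn
  have hn0 : (0 : ℝ) < n := by linarith
  have hκ2 : κ ≤ 1 / 2 := by linarith
  have hα4 : α ≤ 1 / 4 := by linarith
  have hZ4 := arcsineMass_le hα0 hα4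
  have hZ0 : 0 < arcsineMass α := by linarith [one_le_arcsineMass hα0 hα4]
  have hζ0 : 0 < ζ := by linarith
  obtain ⟨s, hs⟩ : ∃ s, s = κ / (200 * n) := ⟨_, rfl⟩
  obtain ⟨γ, hγ⟩ : ∃ γ, γ = 2 * κ / (arcsineMass α * ζ) := ⟨_, rfl⟩
  have hs0 : 0 ≤ s := by rw [hs]; positivity
  have hγ0 : 0 ≤ γ := by rw [hγ]; positivity
  have hsn : s * (200 * n) = κ := by rw [hs]; field_simp
  have hsα' : s ≤ α := by
    rw [hs, hα]
    gcongr
    norm_num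
  have hsα : s ≤ √α :=
    Real.le_sqrt_of_sq_le ((pow_le_of_le_one hs0 (by linarith) two_ne_zero).trans hsα')
  have hns : n * s ^ 2 ≤ 1 := by
    have h1 : s * κ ≤ 1 * 1 := mul_le_mul (by linarith) (by linarith) hκ0.le zero_le_one
    calc n * s ^ 2 = s * (s * (200 * n)) / 200 := by ring
      _ = s * κ / 200 := by rw [hsn]
      _ ≤ 1 := by linarith
  have h := ha.measure_inconsistencies_le (ν := biasLaw α ζ) (M := 1 / √α) (t := β * ℓ) hs0
    hγ0 hσ0 (by positivity) ((ae_biasLaw_abs_phi_le hα0 ζ).mono fun p hp => hp.2)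
    (fun ω j => ha.lintegral_exp_neg_gain_le hS.le hn hκ0 hκ2 hζ hα0 hα4 hγ hs0
      (by linarith) hsα hns ω j)
  refine h.trans (ENNReal.ofReal_le_ofReal ?_)
  rw [Real.rpow_def_of_pos hδ, Real.exp_le_exp, hS]
  have hlog : -L ≤ Real.log δ := by
    rw [← Real.exp_le_exp, hδL, Real.exp_log hδ]
    linarith
  refine (exponent_le hn1 hβ hκ hκ0 hL hζ hα0 (by linarith) hα hσ2 hℓ0 hℓ hZ0 hZ4
    hγ hs).trans ?_
  have hpos : 0 ≤ κ * n * L := mul_nonneg (mul_nonneg hκ0.le hn0.le) (by linarith)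
  linarith [mul_le_mul_of_nonneg_right hlog (show 0 ≤ 1 / 2 * (κ * n) by positivity)]

end

/-! ### Conclusion: union bound over the two failures -/

lemma falseAccusations_tardosCode {α ζ σ : ℝ} (hα : α ∈ Set.Ioo (0 : ℝ) (1 / 2))
    (hζ : ζ ∈ Set.Ioo (0 : ℝ) (1 / 2)) (P : Adversary N n ℓ) (ω : Tape N ℓ) (η : P.Ω) :
    (tardosCode N ℓ α ζ σ hα hζ).falseAccusations P ω η =
      (falselyAccused σ (P.coalition η) ω
        ((tardosCode N ℓ α ζ σ hα hζ).answers P ω η)).card := by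
  unfold Code.falseAccusations
  congr 1
  ext i
  simp only [Finset.mem_sdiff, Finset.mem_biUnion, Finset.mem_univ, true_and,
    falselyAccused, Finset.mem_filter, Finset.mem_compl]
  rw [and_comm]
  exact and_congr_right fun _ => exists_congr fun j => mem_accusedAt_tardosCode hα hζ ω _ j i

/-- A Tardos-type code of sufficient length, with suitable parameters, is collusion resilient. -/
lemma tardosCode_isCollusionResilient {β δ κ L ζ α σ : ℝ} (hn : 1 ≤ n) (hnN : n ≤ N)
    (hβ : 0 ≤ β) (hκ : κ = 1 / 2 - β) (hκ0 : 0 < κ) (hδ : 0 < δ) (hδ1 : δ ≤ 1)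
    (hL : L = Real.log (2 / δ)) (hL2 : 1 / 2 ≤ L) (hζ : ζ = (1 - κ) / 2) (hα : α = κ / (8 * n))
    (hσ : σ = √(8 * ℓ * L)) (hℓ : 2048 * ((n : ℝ) ^ 2 * L / κ ^ 4) ≤ ℓ)
    (hα' : α ∈ Set.Ioo (0 : ℝ) (1 / 2)) (hζ' : ζ ∈ Set.Ioo (0 : ℝ) (1 / 2)) :
    (tardosCode N ℓ α ζ σ hα' hζ').IsCollusionResilient n β
      (min (δ * ((N : ℝ) - n)) ((2 : ℝ) ^ (-(1 / 2 * (δ * ((N : ℝ) - n)))))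
        + δ ^ (1 / 2 * (κ * n))) δ := by
  have hνp := isProbabilityMeasure_biasLaw hα' hζ'
  have hn1 : (1 : ℝ) ≤ n := by exact_mod_cast hn
  have hn0 : (0 : ℝ) < n := by linarith
  have hL0 : 0 < L := by linarith
  have hδL : Real.exp (-L) = δ / 2 := by
    rw [hL, ← Real.log_inv, inv_div, Real.exp_log (by positivity)]
  have hα16 : α ≤ 1 / 16 := by
    rw [hα, div_le_iff₀ (by positivity)]
    linarith
  have hℓ0 : (0 : ℝ) < ℓ := lt_of_lt_of_le (by positivity) hℓ
  have hℓ' : 2048 * ((n : ℝ) ^ 2 * L) ≤ ℓ * κ ^ 4 := by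
    have := mul_le_mul_of_nonneg_right hℓ (show 0 ≤ κ ^ 4 by positivity)
    rwa [mul_assoc, div_mul_cancel₀ _ (show κ ^ 4 ≠ 0 by positivity)] at this
  have hσ0 : 0 ≤ σ := by rw [hσ]; positivity
  have hσ2 : σ ^ 2 = 8 * ℓ * L := by rw [hσ]; exact Real.sq_sqrt (by positivity)
  have hNn : (0 : ℝ) ≤ δ * ((N : ℝ) - n) :=
    mul_nonneg hδ.le (sub_nonneg.2 (by exact_mod_cast hnN))
  have hm0 : 0 ≤ min (δ * ((N : ℝ) - n)) ((2 : ℝ) ^ (-(1 / 2 * (δ * ((N : ℝ) - n))))) :=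
    le_min hNn (Real.rpow_nonneg zero_le_two _)
  have hr0 : 0 ≤ δ ^ (1 / 2 * (κ * n)) := Real.rpow_nonneg hδ.le _
  refine Code.isCollusionResilient_of_forall _ (add_nonneg hm0 hr0) fun P η => ?_
  have ha := isCausal_answers (σ := σ) hα' hζ' P η
  have hSc : ((P.coalition η)ᶜ.card : ℝ) = (N : ℝ) - n := by
    rw [Finset.card_compl, P.card_coalition, Fintype.card_fin, Nat.cast_sub hnN]
  have hfalse := ha.measure_falselyAccused_le_of_length (ζ := ζ) hn1 hκ0 (by linarith) hδ hδ1 hL0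
    hδL hα'.1 hα hσ0 hσ2 hℓ0 hℓ'
  have hcons := ha.measure_inconsistencies_le_of_length (P.card_coalition η) hn hβ hκ hκ0 hδ hL2
    hδL hζ hα'.1 hα16 hα hσ0 hσ2 hℓ0 hℓ'
  rw [hSc] at hfalse
  rw [ENNReal.ofReal_add hm0 hr0, add_comm]
  refine le_trans ?_ (add_le_add hcons hfalse)
  refine le_trans (measure_mono ?_) (measure_union_le _ _)
  rintro ω (hω | hω)
  · exact Or.inl hω
  · exact Or.inr (lt_of_lt_of_eq hω
      (congrArg Nat.cast (falseAccusations_tardosCode hα' hζ' P ω η)))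

end

end IFPC

theorem mainTheorem2 :
    ∃ C c : ℝ, 0 < C ∧ 0 < c ∧
      ∀ (n N : ℕ) (β δ : ℝ), 1 ≤ n → n ≤ N → 0 ≤ β → β < 1 / 2 → 0 < δ → δ ≤ 1 →
        ∃ (ℓ : ℕ) (α ζ σ : ℝ) (hα : α ∈ Set.Ioo (0 : ℝ) (1 / 2))
          (hζ : ζ ∈ Set.Ioo (0 : ℝ) (1 / 2)),
          0 < σ ∧
          (ℓ : ℝ) ≤ C * ((n : ℝ) ^ 2 * Real.log (2 / δ) / (1 / 2 - β) ^ 4) ∧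
          (IFPC.tardosCode N ℓ α ζ σ hα hζ).IsCollusionResilient n β
            (min (δ * ((N : ℝ) - n)) ((2 : ℝ) ^ (-(c * (δ * ((N : ℝ) - n)))))
              + δ ^ (c * ((1 / 2 - β) * n)))
            δ := by
  -- Rounding 2048·X up to an integer adds less than 1 ≤ X, which accounts for 2049; X ≥ 1 since
  -- log(2/δ) ≥ 1/2 and κ⁴ ≤ 1/16.
  refine ⟨2049, 1 / 2, by norm_num, by norm_num, fun n N β δ hn hnN hβ hβ' hδ hδ1 => ?_⟩
  have hn1 : (1 : ℝ) ≤ n := by exact_mod_cast hn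
  have hκ0 : 0 < 1 / 2 - β := by linarith
  have hκ2 : 1 / 2 - β ≤ 1 / 2 := by linarith
  have hL : 1 / 2 ≤ Real.log (2 / δ) := by
    have h : Real.log 2 ≤ Real.log (2 / δ) :=
      Real.log_le_log two_pos (by rw [le_div_iff₀ hδ]; linarith)
    linarith [Real.log_two_gt_d9]
  have hX : 1 ≤ (n : ℝ) ^ 2 * Real.log (2 / δ) / (1 / 2 - β) ^ 4 := by
    rw [one_le_div (by positivity)]
    have h1 : (1 / 2 - β) ^ 4 ≤ (1 / 2) ^ 4 := by gcongr
    nlinarith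
  set X := (n : ℝ) ^ 2 * Real.log (2 / δ) / (1 / 2 - β) ^ 4 with hXd
  have hℓ : 2048 * X ≤ (⌈2048 * X⌉₊ : ℝ) := Nat.le_ceil _
  refine ⟨⌈2048 * X⌉₊, (1 / 2 - β) / (8 * n), (1 - (1 / 2 - β)) / 2,
    √(8 * ⌈2048 * X⌉₊ * Real.log (2 / δ)), ⟨by positivity, ?_⟩, ⟨by linarith, by linarith⟩, ?_, ?_,
    ?_⟩
  · rw [div_lt_iff₀ (by positivity)]
    linarith
  · have : (0 : ℝ) < ⌈2048 * X⌉₊ := by linarith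
    positivity
  · linarith [Nat.ceil_lt_add_one (show 0 ≤ 2048 * X by linarith)]
  · exact IFPC.tardosCode_isCollusionResilient hn hnN hβ rfl hκ0 hδ hδ1 rfl hL rfl rfl rfl hℓ _ _
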